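/- **Setting.** A Bayesian knowledge base $KB$ has as its logic part a finite function-free logic program $PB\cup CB$. The clauses of $PB$ are listed and numbered, and each has the form $$p(\cdot)\leftarrow p_1(\cdot),\dots,p_l(\cdot),\ true,\ \text{context},\ member(X_1,DOM_1),\dots,member(X_s,DOM_s),$$ where the context is a finite list of positive and negative literals, each $DOM_i$ is a finite list of constants, every variable of the head has a type constraint $member(X_i,DOM_i)$, and the predicate symbols $p,p_1,\dots,p_l$ do not occur in $CB$. The predicates $true$ and $member$ have their standard meaning: $true$ is a unit clause, and $member(c,DOM)$ holds exactly for the elements $c$ of the list $DOM$. (The conditional probability tables and the combination rule of $KB$ play no role here.) The Herbrand universe is the set of constants of the program, or one arbitrary constant if there are none. An *influence clause* is an expression $k.\ A\leftarrow A_1,\dots,A_l$ such that $A\leftarrow A_1,\dots,A_l, true,\dots$ is a Herbrand ground instance of the $k$-th clause of $PB$ whose whole body (type constraints included) is true in the well-founded model of $PB\cup CB$. The set of all influence clauses is ${\cal I}_{clause}(KB)$. **SLG-resolution.** SLG-resolution with a fixed computation rule (for example left-most) builds a forest with one tree per subgoal (up to renaming of variables). The nodes of a tree are labelled $H\leftarrow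 D\mid G$ with answer template $H$, delayed literals $D$ and remaining goals $G$. The operations, applied in any order, are: new subgoal; program clause resolution; return of each answer of a table once to each node whose selected literal is positive (the literal is delayed if the answer is conditional, i.e. still has delayed literals); success, failure and delaying of selected ground negative literals; simplification of delayed literals; completion of a set of completely evaluated subgoals (all possible resolutions are performed; there is no early completion); answer completion (failing of unsupported answers). An evaluation *flounders* if some node has a non-ground negative selected literal. A *success branch* is a branch ending in a leaf with no goals and no delayed literals. **Algorithm 2.** Start with ${\cal I}'=\emptyset$. For each predicate symbol $p$ (with arity $n$) in the head of a clause of $PB$, evaluate the goal $\leftarrow p(X_1,\dots,X_n)$ ($X_1,\dots,X_n$ distinct variables) by SLG-resolution until no operation applies. For each success branch of the tree of this goal, add to ${\cal I}'$ the clause $k.\ A\theta\leftarrow A_1\theta,\dots,A_l\theta$, where $A\leftarrow A_1,\dots,A_l,true,\dots$ is the $k$-th clause of $PB$, the one that expands the root, and $\theta$ is the composition of all mgus along the branch. Finally return ${\cal I}'$. If the evaluation of a goal flounders, the algorithm stops there without returning a result. **Theorem.** For every computation rule and every Bayesian knowledge base $KB$, Algorithm 2 terminates: it has no infinite run, in whatever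 order the SLG operations are applied. Every run in which no evaluation flounders ends by returning a finite set ${\cal I}'$, and ${\cal I}'={\cal I}_{clause}(KB)$. -/

import Mathlib

namespace BKB

universe u v

/-! ## Function-free terms, atoms, clauses -/

inductive Term (C : Type u) where
  | var (x : ℕ)
  | const (c : C)
  deriving DecidableEq

/-- Predicate names: ordinary ones, the special predicate `true`, and for every finite list `dom`
of constants the predicate `member(·, dom)`. -/
inductive Pred (C : Type u) (Q : Type v) where
  | user (q : Q)
  | top
  | member (dom : List C)
  deriving DecidableEq

structure Atom (C : Type u) (Q : Type v) where
  pred : Pred C Q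
  args : List (Term C)
  deriving DecidableEq

inductive Literal (C : Type u) (Q : Type v) where
  | pos (a : Atom C Q)
  | neg (a : Atom C Q)
  deriving DecidableEq

structure Clause (C : Type u) (Q : Type v) where
  head : Atom C Q
  body : List (Literal C Q)
  deriving DecidableEq

/-- A logic program, as the list of its clauses. -/
abbrev Program (C : Type u) (Q : Type v) := List (Clause C Q)

abbrev Subst (C : Type u) := ℕ → Term C

section FirstOrder

variable {C : Type u} {Q : Type v}

def Term.subst (θ : Subst C) : Term C → Term C
  | .var x => θ x
  | .const c => .const c

def Atom.subst (θ : Subst C) (a : Atom C Q) : Atom C Q :=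
  ⟨a.pred, a.args.map (Term.subst θ)⟩

def Literal.atom : Literal C Q → Atom C Q
  | .pos a => a
  | .neg a => a

def Literal.subst (θ : Subst C) : Literal C Q → Literal C Q
  | .pos a => .pos (a.subst θ)
  | .neg a => .neg (a.subst θ)

def Clause.subst (θ : Subst C) (c : Clause C Q) : Clause C Q :=
  ⟨c.head.subst θ, c.body.map (Literal.subst θ)⟩

/-- `θ.comp η` is: first `θ`, then `η`. -/
def Subst.comp (θ η : Subst C) : Subst C := fun x => (θ x).subst η

def Term.var? : Term C → Option ℕ
  | .var x => some x
  | .const _ => none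

def Term.const? : Term C → Option C
  | .var _ => none
  | .const c => some c

/-- The variables of an atom, in order of occurrence. -/
def Atom.vars (a : Atom C Q) : List ℕ := a.args.filterMap Term.var?

def Atom.consts (a : Atom C Q) : List C := a.args.filterMap Term.const?

def Atom.IsGround (a : Atom C Q) : Prop := a.vars = []

/-- The predicate symbol of an atom: its name together with its arity. -/
def Atom.sym (a : Atom C Q) : Pred C Q × ℕ := (a.pred, a.args.length)

/-- The canonical variant of an atom: every variable is renamed to the index of its first
occurrence. Two atoms are variants of each other iff their canonical variants are equal. -/
def Atom.norm (a : Atom C Q) : Atom C Q := a.subst fun x => .var (a.vars.idxOf x)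

/-- `p(X₁, …, Xₙ)` with pairwise distinct variables. -/
def mostGeneral (s : Pred C Q × ℕ) : Atom C Q := ⟨s.1, (List.range s.2).map Term.var⟩

def Clause.atoms (c : Clause C Q) : List (Atom C Q) := c.head :: c.body.map Literal.atom

end FirstOrder

/-! ## Herbrand universe, Herbrand base, well-founded model -/

section WellFoundedSemantics

variable {C : Type u} {Q : Type v}

def constsOf (P : Program C Q) : Set C :=
  {c | ∃ cl ∈ P, ∃ a ∈ cl.atoms, c ∈ a.consts}

open Classical in
/-- The Herbrand universe: all constants of the program, or one arbitrary constant if there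
are none. -/
noncomputable def HU [Inhabited C] (P : Program C Q) : Set C :=
  if (constsOf P).Nonempty then constsOf P else {default}

/-- The Herbrand base. -/
def HB [Inhabited C] (P : Program C Q) : Set (Atom C Q) :=
  {a | a.IsGround ∧ (∃ cl ∈ P, ∃ b ∈ cl.atoms, b.sym = a.sym) ∧ ∀ c ∈ a.consts, c ∈ HU P}

/-- The substitution replacing every variable by a constant. -/
def groundSubst (σ : ℕ → C) : Subst C := fun x => .const (σ x)

/-- The Herbrand instantiation of a program. -/
def groundInstances [Inhabited C] (P : Program C Q) : Set (Clause C Q) :=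
  {g | ∃ cl ∈ P, ∃ σ : ℕ → C, (∀ x, σ x ∈ HU P) ∧ g = cl.subst (groundSubst σ)}

/-- Partial interpretations `⟨I_t, I_f⟩`: the true atoms and the false atoms. -/
abbrev PartialInterp (C : Type u) (Q : Type v) := Set (Atom C Q) × Set (Atom C Q)

def LitTrue (I : PartialInterp C Q) : Literal C Q → Prop
  | .pos a => a ∈ I.1
  | .neg a => a ∈ I.2

def LitFalse (I : PartialInterp C Q) : Literal C Q → Prop
  | .pos a => a ∈ I.2
  | .neg a => a ∈ I.1

theorem LitTrue.mono {I J : PartialInterp C Q} (h : I ≤ J) {L : Literal C Q}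
    (hL : LitTrue I L) : LitTrue J L := by
  cases L with
  | pos a => exact h.1 hL
  | neg a => exact h.2 hL

theorem LitFalse.mono {I J : PartialInterp C Q} (h : I ≤ J) {L : Literal C Q}
    (hL : LitFalse I L) : LitFalse J L := by
  cases L with
  | pos a => exact h.2 hL
  | neg a => exact h.1 hL

/-- `U` is an unfounded set of `P` with respect to `I`. -/
def IsUnfounded [Inhabited C] (P : Program C Q) (I : PartialInterp C Q)
    (U : Set (Atom C Q)) : Prop :=
  U ⊆ HB P ∧ ∀ a ∈ U, ∀ g ∈ groundInstances P, g.head = a →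
    ∃ L ∈ g.body, LitFalse I L ∨ ∃ b ∈ U, L = .pos b

/-- The immediate consequences of `I`. -/
def consequences [Inhabited C] (P : Program C Q) (I : PartialInterp C Q) : Set (Atom C Q) :=
  {a | ∃ g ∈ groundInstances P, g.head = a ∧ ∀ L ∈ g.body, LitTrue I L}

/-- The greatest unfounded set of `P` with respect to `I`. -/
def greatestUnfounded [Inhabited C] (P : Program C Q) (I : PartialInterp C Q) :
    Set (Atom C Q) :=
  ⋃₀ {U | IsUnfounded P I U}

/-- The operator `W_P`, with its monotonicity. -/
def wfOperator [Inhabited C] (P : Program C Q) : PartialInterp C Q →o PartialInterp C Q where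
  toFun I := (consequences P I, greatestUnfounded P I)
  monotone' := by
    intro I J h
    refine ⟨?_, ?_⟩
    · rintro a ⟨g, hg, rfl, hb⟩
      exact ⟨g, hg, rfl, fun L hL => (hb L hL).mono h⟩
    · rintro a ⟨U, hU, ha⟩
      refine ⟨U, ⟨hU.1, fun b hb g hg hgb => ?_⟩, ha⟩
      obtain ⟨L, hL, hLf⟩ := hU.2 b hb g hg hgb
      exact ⟨L, hL, hLf.imp (fun h' => h'.mono h) id⟩

/-- The well-founded model: the least fixpoint of `W_P`. -/
def wellFoundedModel [Inhabited C] (P : Program C Q) : PartialInterp C Q :=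
  OrderHom.lfp (wfOperator P)

end WellFoundedSemantics

/-! ## Bayesian knowledge bases and influence clauses -/

/-- A clause of `PB`:
`head ← direct, true, context, member(X₁, DOM₁), …, member(Xₛ, DOMₛ)`. -/
structure PBClause (C : Type u) (Q : Type v) where
  head : Atom C Q
  direct : List (Atom C Q)
  context : List (Literal C Q)
  types : List (ℕ × List C)

section KnowledgeBase

variable {C : Type u} {Q : Type v}

def PBClause.toClause (c : PBClause C Q) : Clause C Q where
  head := c.head
  body := c.direct.map Literal.pos ++ Literal.pos ⟨.top, []⟩ :: c.context ++
    c.types.map fun t => Literal.pos ⟨.member t.2, [.var t.1]⟩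

/-- The unit clauses `member(c, dom)` with `c ∈ dom`, for the domains occurring in a clause. -/
def Clause.memberFacts (c : Clause C Q) : Program C Q :=
  c.body.flatMap fun L =>
    match L.atom.pred with
    | .member dom => dom.map fun d => ⟨⟨.member dom, [.const d]⟩, []⟩
    | _ => []

end KnowledgeBase

/-- The logic part `PB ∪ CB` of a Bayesian knowledge base. The conditional probability tables and
the combination rule have no bearing on influence clauses. The clauses by which `CB` defines the
auxiliary predicates `true` and `member` are not listed in `CB`; `program` adds them. -/
structure KnowledgeBase (C : Type u) (Q : Type v) where
  PB : List (PBClause C Q)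
  CB : Program C Q
  /-- `true` and `member` are not direct influences and are not redefined. -/
  user_PB : ∀ c ∈ PB, ∀ a ∈ c.head :: c.direct, ∃ q, a.pred = .user q
  user_CB : ∀ c ∈ CB, ∃ q, c.head.pred = .user q
  /-- The predicate symbols of heads and direct influences do not occur in `CB`. -/
  only_PB : ∀ c ∈ PB, ∀ a ∈ c.head :: c.direct, ∀ d ∈ CB, ∀ b ∈ d.atoms, b.sym ≠ a.sym
  /-- Every variable in the head has a type constraint. -/
  typed : ∀ c ∈ PB, ∀ x ∈ c.head.vars, ∃ t ∈ c.types, t.1 = x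

/-- An influence clause `index. head ← parents`; the index is the position (from 0) in `PB`. -/
structure InfluenceClause (C : Type u) (Q : Type v) where
  index : ℕ
  head : Atom C Q
  parents : List (Atom C Q)

section KnowledgeBase

variable {C : Type u} {Q : Type v}

/-- The program `PB ∪ CB`, with the unit clauses for `true` and `member`. Its first `PB.length`
clauses are those of `PB`. -/
def KnowledgeBase.program (KB : KnowledgeBase C Q) : Program C Q :=
  KB.PB.map PBClause.toClause ++ KB.CB ++ ⟨⟨.top, []⟩, []⟩ ::
    (KB.PB.map PBClause.toClause ++ KB.CB).flatMap Clause.memberFacts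

def PBClause.influence (k : ℕ) (c : PBClause C Q) (θ : Subst C) : InfluenceClause C Q :=
  ⟨k, c.head.subst θ, c.direct.map (Atom.subst θ)⟩

/-- The set of influence clauses of `KB`. -/
def KnowledgeBase.influenceClauses [Inhabited C] (KB : KnowledgeBase C Q) :
    Set (InfluenceClause C Q) :=
  {ι | ∃ (k : ℕ) (c : PBClause C Q), KB.PB[k]? = some c ∧ ∃ σ : ℕ → C, (∀ x, σ x ∈ HU KB.program) ∧
    (∀ L ∈ (c.toClause.subst (groundSubst σ)).body,
      LitTrue (wellFoundedModel KB.program) L) ∧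
    ι = c.influence k (groundSubst σ)}

end KnowledgeBase

/-! ## Unification -/

section Unification

variable {C : Type u} {Q : Type v} [DecidableEq C] [DecidableEq Q]

def Subst.single (x : ℕ) (t : Term C) : Subst C := fun y => if y = x then t else .var y

/-- Robinson's algorithm for function-free terms, extending the substitution `θ`. -/
def unify (θ : Subst C) : List (Term C × Term C) → Option (Subst C)
  | [] => some θ
  | (s, t) :: r =>
    match s.subst θ, t.subst θ with
    | .const c, .const d => if c = d then unify θ r else none
    | .var x, t' => unify (θ.comp (Subst.single x t')) r
    | .const c, .var y => unify (θ.comp (Subst.single y (.const c))) r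

/-- The most general unifier of `a` and `b`, standardized apart (the variables `x` of `a` become
`2x`, those of `b` become `2x+1`), restricted to the variables of `a`. -/
def mguApart (a b : Atom C Q) : Option (Subst C) :=
  if a.sym = b.sym then
    (unify Term.var (List.zip
      (a.args.map (Term.subst fun x => .var (2 * x)))
      (b.args.map (Term.subst fun x => .var (2 * x + 1))))).map fun μ x => μ (2 * x)
  else none

end Unification

/-! ## SLG-resolution -/

/-- Delayed literals: a negative literal, or a positive literal that was resolved with the
conditional answer `answer` from the table of `call`. -/
inductive Delayed (C : Type u) (Q : Type v) where
  | neg (a : Atom C Q)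
  | pos (call answer : Atom C Q)
  deriving DecidableEq

/-- The edges of SLG trees: resolution with the `k`-th program clause; return of an answer (the
flag tells whether the literal gets delayed because the answer is conditional); success of a
negative literal; delaying of a negative literal; deletion of a delayed literal; failure. -/
inductive Edge (C : Type u) (Q : Type v) where
  | clause (k : ℕ)
  | answer (a : Atom C Q) (conditional : Bool)
  | negSuccess
  | delay
  | simplify (d : Delayed C Q)
  | fail
  deriving DecidableEq

/-- A node of an SLG tree is given by the branch leading to it: the edges from the root to the
node, last edge first. The root is the empty branch and the children of `b` are `e :: b`. -/
abbrev Branch (C : Type u) (Q : Type v) := List (Edge C Q)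

/-- The label `head ← delays | goals` of a node, with the index of the program clause expanding
the root and the composition `subst` of all mgus along the branch (on the variables of that
clause). -/
structure Label (C : Type u) (Q : Type v) where
  clause : ℕ
  subst : Subst C
  head : Atom C Q
  goals : List (Literal C Q)
  delays : List (Delayed C Q)

/-- A computation rule selects a literal in every non-empty list of literals. -/
structure ComputationRule (C : Type u) (Q : Type v) where
  select : List (Literal C Q) → ℕ
  select_lt : ∀ gs, gs ≠ [] → select gs < gs.length

/-- A forest of SLG trees. The pair `(S, b)` in `nodes` is the node `b` of the tree for the
subgoal `S` (a canonical variant); `completed` is the set of completed subgoals. -/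
@[ext] structure Forest (C : Type u) (Q : Type v) where
  nodes : Set (Atom C Q × Branch C Q)
  completed : Set (Atom C Q)

section SLG

variable {C : Type u} {Q : Type v} [DecidableEq C] [DecidableEq Q]

/-- The selected literal and the remaining ones. -/
def ComputationRule.pick (R : ComputationRule C Q) (gs : List (Literal C Q)) :
    Option (Literal C Q × List (Literal C Q)) :=
  gs[R.select gs]?.map fun L => (L, gs.eraseIdx (R.select gs))

/-- The label of the node `b` in the tree for `S`; there is none for the root (which stands for
`S ← | S`), for failure nodes, and where resolution is impossible. -/
def label (P : Program C Q) (R : ComputationRule C Q) (S : Atom C Q) :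
    Branch C Q → Option (Label C Q)
  | [] => none
  | .clause k :: [] =>
    P[k]?.bind fun c =>
      (mguApart c.head S).map fun θ =>
        ⟨k, θ, c.head.subst θ, c.body.map (Literal.subst θ), []⟩
  | .clause _ :: _ :: _ => none
  | .answer h conditional :: b =>
    (label P R S b).bind fun N =>
      match R.pick N.goals with
      | some (.pos a, rest) =>
        (mguApart a h).map fun μ =>
          ⟨N.clause, N.subst.comp μ, N.head.subst μ, rest.map (Literal.subst μ),
            if conditional then .pos a.norm h :: N.delays else N.delays⟩
      | _ => none
  | .negSuccess :: b =>
    (label P R S b).bind fun N =>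
      match R.pick N.goals with
      | some (.neg _, rest) => some { N with goals := rest }
      | _ => none
  | .delay :: b =>
    (label P R S b).bind fun N =>
      match R.pick N.goals with
      | some (.neg a, rest) => some { N with goals := rest, delays := .neg a :: N.delays }
      | _ => none
  | .simplify d :: b =>
    (label P R S b).map fun N => { N with delays := N.delays.filter (· ≠ d) }
  | .fail :: _ => none

namespace Forest

/-- The forest consisting of the root of the tree for `S`. -/
def init (S : Atom C Q) : Forest C Q := ⟨{(S, [])}, ∅⟩

def addNode (F : Forest C Q) (S : Atom C Q) (b : Branch C Q) : Forest C Q :=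
  ⟨insert (S, b) F.nodes, F.completed⟩

def HasTree (F : Forest C Q) (S : Atom C Q) : Prop := (S, []) ∈ F.nodes

def IsLeaf (F : Forest C Q) (S : Atom C Q) (b : Branch C Q) : Prop :=
  (S, b) ∈ F.nodes ∧ ∀ e, (S, e :: b) ∉ F.nodes

variable (P : Program C Q) (R : ComputationRule C Q) (F : Forest C Q)

/-- `b` is a node of the tree for `S`, with label `N` and selected literal `L`. -/
def Selects (S : Atom C Q) (b : Branch C Q) (N : Label C Q) (L : Literal C Q) : Prop :=
  (S, b) ∈ F.nodes ∧ label P R S b = some N ∧ ∃ rest, R.pick N.goals = some (L, rest)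

/-- `b` is an answer node `head ← delays |` of `S`. -/
def IsAnswer (S : Atom C Q) (b : Branch C Q) (N : Label C Q) : Prop :=
  F.IsLeaf S b ∧ label P R S b = some N ∧ N.goals = []

/-- The table of `S` contains the answer `h`. -/
def HasAnswer (S h : Atom C Q) : Prop :=
  ∃ b N, F.IsAnswer P R S b N ∧ N.head.norm = h

/-- `h` is an unconditional answer of `S`. -/
def HasUnconditional (S h : Atom C Q) : Prop :=
  ∃ b N, F.IsAnswer P R S b N ∧ N.delays = [] ∧ N.head.norm = h

def Succeeds : Delayed C Q → Prop
  | .neg a => a ∈ F.completed ∧ ¬ ∃ h, F.HasAnswer P R a h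
  | .pos S h => F.HasUnconditional P R S h

def Fails : Delayed C Q → Prop
  | .neg a => F.HasUnconditional P R a a
  | .pos S h => S ∈ F.completed ∧ ¬ F.HasAnswer P R S h

/-- The answer `h` of `S` is supported. -/
inductive Supported : Atom C Q → Atom C Q → Prop
  | incomplete (S h : Atom C Q) : S ∉ F.completed → Supported S h
  | answer (S : Atom C Q) (b : Branch C Q) (N : Label C Q) :
      F.IsAnswer P R S b N →
      (∀ S' h', Delayed.pos S' h' ∈ N.delays → Supported S' h') →
      Supported S N.head.norm

/-- The set `G` of subgoals is completely evaluated: program clause resolution has been carried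
out, the subgoals of all selected literals are completed or in `G`, every available answer has been
returned and every selected negative literal has been resolved or delayed. -/
def CompletelyEvaluated (G : Set (Atom C Q)) : Prop :=
  ∀ S ∈ G, F.HasTree S ∧
    (∀ k, (label P R S [.clause k]).isSome → (S, [.clause k]) ∈ F.nodes) ∧
    ∀ b N L, F.Selects P R S b N L →
      (F.HasTree L.atom.norm ∧ (L.atom.norm ∈ F.completed ∨ L.atom.norm ∈ G)) ∧
      match L with
      | .pos a => ∀ h, F.HasAnswer P R a.norm h →
          (label P R S (.answer h false :: b)).isSome →
            ∃ conditional, (S, .answer h conditional :: b) ∈ F.nodes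
      | .neg _ => ∃ e, (S, e :: b) ∈ F.nodes

/-- Some node has a non-ground negative selected literal. -/
def Flounders : Prop :=
  ∃ S b N a, F.Selects P R S b N (.neg a) ∧ ¬ a.IsGround

end Forest

/-- The operations of SLG-resolution. -/
inductive SLGStep (P : Program C Q) (R : ComputationRule C Q) : Forest C Q → Forest C Q → Prop
  /-- A subgoal is selected for the first time. -/
  | newSubgoal (F : Forest C Q) (S : Atom C Q) (b : Branch C Q) (N : Label C Q)
      (L : Literal C Q) :
      F.Selects P R S b N L → (∀ a, L = .neg a → a.IsGround) → ¬ F.HasTree L.atom.norm →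
      SLGStep P R F (F.addNode L.atom.norm [])
  | programClause (F : Forest C Q) (S : Atom C Q) (k : ℕ) :
      F.HasTree S → (label P R S [.clause k]).isSome → (S, [.clause k]) ∉ F.nodes →
      SLGStep P R F (F.addNode S [.clause k])
  /-- An unconditional answer is returned to a positive literal. -/
  | positiveReturn (F : Forest C Q) (S : Atom C Q) (b : Branch C Q) (N : Label C Q)
      (a h : Atom C Q) :
      F.Selects P R S b N (.pos a) → F.HasUnconditional P R a.norm h →
      (label P R S (.answer h false :: b)).isSome →
      (∀ conditional, (S, .answer h conditional :: b) ∉ F.nodes) →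
      SLGStep P R F (F.addNode S (.answer h false :: b))
  /-- A conditional answer is returned to a positive literal, which gets delayed. -/
  | positiveDelay (F : Forest C Q) (S : Atom C Q) (b : Branch C Q) (N : Label C Q)
      (a h : Atom C Q) :
      F.Selects P R S b N (.pos a) → F.HasAnswer P R a.norm h →
      ¬ F.HasUnconditional P R a.norm h →
      (label P R S (.answer h true :: b)).isSome →
      (∀ conditional, (S, .answer h conditional :: b) ∉ F.nodes) →
      SLGStep P R F (F.addNode S (.answer h true :: b))
  | negationSuccess (F : Forest C Q) (S : Atom C Q) (b : Branch C Q) (N : Label C Q)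
      (a : Atom C Q) :
      F.Selects P R S b N (.neg a) → F.IsLeaf S b → a.IsGround → F.Succeeds P R (.neg a) →
      SLGStep P R F (F.addNode S (.negSuccess :: b))
  | negationFailure (F : Forest C Q) (S : Atom C Q) (b : Branch C Q) (N : Label C Q)
      (a : Atom C Q) :
      F.Selects P R S b N (.neg a) → F.IsLeaf S b → a.IsGround → F.Fails P R (.neg a) →
      SLGStep P R F (F.addNode S (.fail :: b))
  | delaying (F : Forest C Q) (S : Atom C Q) (b : Branch C Q) (N : Label C Q)
      (a : Atom C Q) :
      F.Selects P R S b N (.neg a) → F.IsLeaf S b → a.IsGround → F.HasTree a →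
      ¬ F.Succeeds P R (.neg a) → ¬ F.Fails P R (.neg a) →
      SLGStep P R F (F.addNode S (.delay :: b))
  | simplifySuccess (F : Forest C Q) (S : Atom C Q) (b : Branch C Q) (N : Label C Q)
      (d : Delayed C Q) :
      F.IsAnswer P R S b N → d ∈ N.delays → F.Succeeds P R d →
      SLGStep P R F (F.addNode S (.simplify d :: b))
  | simplifyFailure (F : Forest C Q) (S : Atom C Q) (b : Branch C Q) (N : Label C Q)
      (d : Delayed C Q) :
      F.IsAnswer P R S b N → d ∈ N.delays → F.Fails P R d →
      SLGStep P R F (F.addNode S (.fail :: b))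
  | completion (F : Forest C Q) (G : Set (Atom C Q)) :
      G.Nonempty → Disjoint G F.completed → F.CompletelyEvaluated P R G →
      SLGStep P R F ⟨F.nodes, F.completed ∪ G⟩
  | answerCompletion (F : Forest C Q) (S : Atom C Q) (b : Branch C Q) (N : Label C Q) :
      F.IsAnswer P R S b N → ¬ F.Supported P R S N.head.norm →
      SLGStep P R F (F.addNode S (.fail :: b))

/-! ## The algorithm computing influence clauses -/

/-- The most general goals `p(X₁, …, Xₙ)`, for the predicate symbols in the heads of `PB`. -/
def KnowledgeBase.topGoals (KB : KnowledgeBase C Q) : List (Atom C Q) :=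
  (KB.PB.map fun c => c.head.sym).dedup.map mostGeneral

/-- The influence clauses produced by the success branches (branches ending in a leaf without goals
and delayed literals) of the tree for `S`: if the `k`-th clause of `PB` expands the root and `θ` is
the composition of all mgus along the branch, the head and the direct influences of that clause
under `θ`. -/
def KnowledgeBase.collect (KB : KnowledgeBase C Q) (R : ComputationRule C Q) (F : Forest C Q)
    (S : Atom C Q) : Set (InfluenceClause C Q) :=
  {ι | ∃ (b : Branch C Q) (N : Label C Q) (c : PBClause C Q),
    F.IsAnswer KB.program R S b N ∧ N.delays = [] ∧
    KB.PB[N.clause]? = some c ∧ ι = c.influence N.clause N.subst}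

/-- The goals still to be treated, the goal under evaluation with its forest, and the influence
clauses collected from the goals already evaluated. -/
structure AlgState (C : Type u) (Q : Type v) where
  pending : List (Atom C Q)
  current : Option (Atom C Q × Forest C Q)
  collected : Set (InfluenceClause C Q)

def KnowledgeBase.start (KB : KnowledgeBase C Q) : AlgState C Q := ⟨KB.topGoals, none, ∅⟩

/-- The steps of the algorithm. A goal is finished when no SLG operation applies to its forest and
its evaluation has not floundered. -/
inductive KnowledgeBase.AlgStep (KB : KnowledgeBase C Q) (R : ComputationRule C Q) :
    AlgState C Q → AlgState C Q → Prop
  | next (S : Atom C Q) (gs : List (Atom C Q)) (out : Set (InfluenceClause C Q)) :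
      KB.AlgStep R ⟨S :: gs, none, out⟩ ⟨gs, some (S, Forest.init S), out⟩
  | slg (S : Atom C Q) (F F' : Forest C Q) (gs : List (Atom C Q))
      (out : Set (InfluenceClause C Q)) :
      SLGStep KB.program R F F' →
      KB.AlgStep R ⟨gs, some (S, F), out⟩ ⟨gs, some (S, F'), out⟩
  | finish (S : Atom C Q) (F : Forest C Q) (gs : List (Atom C Q))
      (out : Set (InfluenceClause C Q)) :
      (∀ F', ¬ SLGStep KB.program R F F') → ¬ F.Flounders KB.program R →
      KB.AlgStep R ⟨gs, some (S, F), out⟩ ⟨gs, none, out ∪ KB.collect R F S⟩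

/-- The algorithm can return: all goals have been evaluated. -/
def AlgState.Returned (s : AlgState C Q) : Prop := s.pending = [] ∧ s.current = none

/-- The current evaluation has floundered. -/
def KnowledgeBase.Floundered (KB : KnowledgeBase C Q) (R : ComputationRule C Q)
    (s : AlgState C Q) : Prop :=
  ∃ S F, s.current = some (S, F) ∧ F.Flounders KB.program R

end SLG

end BKB

/-!
SLG-resolution is sound and complete for the well-founded model, and for function-free programs it
has only finitely many forests to move through.

*Termination.* Subgoals and answers are canonical variants over the finitely many predicate symbols
and constants of the program. Below the children of a root, every edge except a final failure lowers
twice the number of goals plus the number of delayed literals, so branches are bounded in length and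
all nodes lie in one finite set.
Each operation adds a node or a completed subgoal (`Forest.Sound.size_lt`, `Forest.Sound.size_le`).

*The invariant* `Forest.Sound` says in particular that every body literal of the clause expanding a
tree is, at each node, still a goal, or true in the well-founded model `M`, or dependent on a
delayed literal (`LabelSound`, `Justified`); that completed tables remain completely evaluated; and
that each failed node has a lasting reason. The last point rests on `SLGStep.supported`: an answer without
support never regains it. Preservation of the invariant needs the two halves of soundness:

* ground instances of unconditional answers are true in `M` (`Forest.Sound.mem_true`);
* the ground instances of completed subgoals that no supported answer covers form an unfounded set
  with respect to `M`, so they are false in `M` (`Forest.Sound.mem_false`).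

The second half, like the completeness of success branches, follows a ground clause instance through
the tree of a completed subgoal to an answer node (`Forest.Sound.exists_branch`).

*Completeness.* When no operation applies and no node flounders, all subgoals are completed, and the
tables define an interpretation `J`. Its meet with `M` is closed under the operator `W_P`:
consequences of `M ⊓ J` have unconditional answers, because all delayed literals along the matching
branch could be simplified; an atom of an unfounded set of `M ⊓ J` is covered by no answer, by induction on the
support of the answer and consistency of `M`. As `M` is the least fixpoint, `M ≤ J`
(`Forest.Sound.wellFoundedModel_le_tableInterp`).

*Influence clauses.* The type constraints make all answers for head and direct influence predicates
ground (`KnowledgeBase.rangeRestricted`), so the substitution at a success branch determines exactly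
one influence clause (`Forest.Sound.collect_eq`).
-/

namespace BKB

universe u v

/-! ### Substitutions and instances -/

section FirstOrder

variable {C : Type u} {Q : Type v}

theorem Term.subst_comp (θ η : Subst C) (t : Term C) :
    t.subst (θ.comp η) = (t.subst θ).subst η := by
  cases t <;> rfl

theorem Term.subst_var (t : Term C) : t.subst Term.var = t := by
  cases t <;> rfl

theorem Subst.comp_assoc (θ η ζ : Subst C) : (θ.comp η).comp ζ = θ.comp (η.comp ζ) := by
  funext x
  exact (Term.subst_comp η ζ (θ x)).symm

theorem Atom.subst_comp (θ η : Subst C) (a : Atom C Q) :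
    a.subst (θ.comp η) = (a.subst θ).subst η := by
  simp only [Atom.subst, List.map_map, Atom.mk.injEq, true_and]
  exact List.map_congr_left fun t _ => Term.subst_comp θ η t

theorem Literal.subst_comp (θ η : Subst C) (L : Literal C Q) :
    L.subst (θ.comp η) = (L.subst θ).subst η := by
  cases L <;> simp [Literal.subst, Atom.subst_comp]

theorem Literal.atom_subst (θ : Subst C) (L : Literal C Q) :
    (L.subst θ).atom = L.atom.subst θ := by
  cases L <;> rfl

theorem Atom.subst_var (a : Atom C Q) : a.subst Term.var = a := by
  have h : Term.subst Term.var = (id : Term C → Term C) := funext Term.subst_var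
  simp [Atom.subst, h]

theorem Atom.sym_subst (θ : Subst C) (a : Atom C Q) : (a.subst θ).sym = a.sym := by
  simp [Atom.sym, Atom.subst]

theorem Atom.mem_vars {a : Atom C Q} {x : ℕ} : x ∈ a.vars ↔ Term.var x ∈ a.args := by
  simp only [Atom.vars, List.mem_filterMap]
  constructor
  · rintro ⟨t, ht, h⟩
    cases t with
    | var y =>
      simp only [Term.var?, Option.some.injEq] at h
      exact h ▸ ht
    | const c => simp [Term.var?] at h
  · exact fun h => ⟨_, h, rfl⟩

theorem Atom.mem_consts {a : Atom C Q} {c : C} : c ∈ a.consts ↔ Term.const c ∈ a.args := by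
  simp only [Atom.consts, List.mem_filterMap]
  constructor
  · rintro ⟨t, ht, h⟩
    cases t with
    | var y => simp [Term.const?] at h
    | const d =>
      simp only [Term.const?, Option.some.injEq] at h
      exact h ▸ ht
  · exact fun h => ⟨_, h, rfl⟩

theorem Atom.isGround_iff {a : Atom C Q} : a.IsGround ↔ ∀ x, Term.var x ∉ a.args := by
  simp only [Atom.IsGround, List.eq_nil_iff_forall_not_mem, Atom.mem_vars]

theorem Atom.subst_congr {θ η : Subst C} {a : Atom C Q} (h : ∀ x ∈ a.vars, θ x = η x) :
    a.subst θ = a.subst η := by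
  simp only [Atom.subst, Atom.mk.injEq, true_and]
  refine List.map_congr_left fun t ht => ?_
  cases t with
  | var x => exact h x (Atom.mem_vars.2 ht)
  | const c => rfl

theorem Atom.IsGround.subst_eq {a : Atom C Q} (h : a.IsGround) (θ : Subst C) :
    a.subst θ = a := by
  conv_rhs => rw [← a.subst_var]
  refine Atom.subst_congr fun x hx => ?_
  rw [Atom.IsGround] at h
  simp [h] at hx

theorem Atom.IsGround.norm_eq {a : Atom C Q} (h : a.IsGround) : a.norm = a := h.subst_eq _

theorem Atom.isGround_subst_of {a : Atom C Q} {θ : Subst C}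
    (h : ∀ x ∈ a.vars, ∃ c, θ x = .const c) : (a.subst θ).IsGround := by
  rw [Atom.isGround_iff]
  intro x hx
  simp only [Atom.subst, List.mem_map] at hx
  obtain ⟨t, ht, h'⟩ := hx
  cases t with
  | var y =>
    obtain ⟨c, hc⟩ := h y (Atom.mem_vars.2 ht)
    simp [Term.subst, hc] at h'
  | const c => simp [Term.subst] at h'

theorem Atom.isGround_groundSubst (a : Atom C Q) (σ : ℕ → C) :
    (a.subst (groundSubst σ)).IsGround :=
  Atom.isGround_subst_of fun _ _ => ⟨_, rfl⟩

theorem Atom.exists_const_of_isGround_subst {a : Atom C Q} {θ : Subst C}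
    (h : (a.subst θ).IsGround) {x : ℕ} (hx : x ∈ a.vars) :
    ∃ c ∈ (a.subst θ).consts, θ x = .const c := by
  have hm : θ x ∈ (a.subst θ).args := List.mem_map.2 ⟨_, Atom.mem_vars.1 hx, rfl⟩
  cases hθ : θ x with
  | var y => exact absurd (hθ ▸ hm) (Atom.isGround_iff.1 h y)
  | const c => exact ⟨c, Atom.mem_consts.2 (hθ ▸ hm), rfl⟩

/-- The variables of a canonical variant are positions in a list of at most arity many
variables. -/
theorem Atom.lt_of_mem_vars_norm {a : Atom C Q} {x : ℕ} (hx : x ∈ a.norm.vars) :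
    x < a.norm.args.length := by
  rw [Atom.mem_vars] at hx
  simp only [Atom.norm, Atom.subst, List.mem_map, List.length_map] at hx ⊢
  obtain ⟨t, ht, h⟩ := hx
  cases t with
  | var y =>
    simp only [Term.subst, Term.var.injEq] at h
    rw [← h]
    exact (List.idxOf_lt_length_iff.2 (Atom.mem_vars.2 ht)).trans_le
      (List.length_filterMap_le _ _)
  | const c => simp [Term.subst] at h

/-- `g` is an instance of `h`. No condition is imposed on the substitution, not even when `g` is
ground: its values outside the variables of `h` are irrelevant. -/
def Inst (g h : Atom C Q) : Prop := ∃ ρ : Subst C, g = h.subst ρ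

theorem Inst.refl (a : Atom C Q) : Inst a a := ⟨_, a.subst_var.symm⟩

theorem Inst.trans {a b c : Atom C Q} (h : Inst a b) (h' : Inst b c) : Inst a c := by
  obtain ⟨ρ, rfl⟩ := h
  obtain ⟨η, rfl⟩ := h'
  exact ⟨η.comp ρ, (Atom.subst_comp _ _ _).symm⟩

theorem inst_subst (a : Atom C Q) (θ : Subst C) : Inst (a.subst θ) a := ⟨θ, rfl⟩

theorem inst_norm_left (a : Atom C Q) : Inst a.norm a := ⟨_, rfl⟩

theorem inst_norm_right (a : Atom C Q) : Inst a a.norm := by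
  refine ⟨fun i => .var (a.vars.getD i 0), ?_⟩
  conv_lhs => rw [← a.subst_var]
  rw [Atom.norm, ← Atom.subst_comp]
  refine Atom.subst_congr fun x hx => ?_
  have hlt : a.vars.idxOf x < a.vars.length := List.idxOf_lt_length_iff.2 hx
  simp [Subst.comp, Term.subst, List.getD_eq_getElem?_getD, hlt]

theorem Inst.eq_of_isGround {a b : Atom C Q} (h : Inst a b) (hb : b.IsGround) : a = b := by
  obtain ⟨ρ, rfl⟩ := h
  exact hb.subst_eq ρ

theorem Inst.sym_eq {a b : Atom C Q} (h : Inst a b) : a.sym = b.sym := by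
  obtain ⟨ρ, rfl⟩ := h
  exact b.sym_subst ρ

theorem Inst.isGround {a b : Atom C Q} (h : Inst a b) (hb : b.IsGround) : a.IsGround :=
  h.eq_of_isGround hb ▸ hb

theorem Atom.isGround_norm {a : Atom C Q} : a.norm.IsGround ↔ a.IsGround :=
  ⟨(inst_norm_right a).isGround, (inst_norm_left a).isGround⟩

theorem Atom.mem_consts_subst {a : Atom C Q} {θ : Subst C} {c : C}
    (h : c ∈ (a.subst θ).consts) : c ∈ a.consts ∨ ∃ x ∈ a.vars, θ x = .const c := by
  rw [Atom.mem_consts] at h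
  simp only [Atom.subst, List.mem_map] at h
  obtain ⟨t, ht, h⟩ := h
  cases t with
  | var x => exact .inr ⟨x, Atom.mem_vars.2 ht, h⟩
  | const d =>
    simp only [Term.subst, Term.const.injEq] at h
    exact .inl (Atom.mem_consts.2 (h ▸ ht))

theorem Atom.mem_consts_norm {a : Atom C Q} {c : C} (h : c ∈ a.norm.consts) : c ∈ a.consts := by
  rcases Atom.mem_consts_subst h with h | ⟨x, -, h⟩
  · exact h
  · cases h

theorem inst_mostGeneral (a : Atom C Q) : Inst a (mostGeneral a.sym) := by
  refine ⟨fun i => a.args.getD i (.var 0), ?_⟩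
  obtain ⟨p, l⟩ := a
  simp only [Atom.subst, mostGeneral, Atom.sym, List.map_map, Atom.mk.injEq, true_and]
  refine List.ext_getElem (by simp) fun i h1 h2 => ?_
  simp [Term.subst, h1]

theorem Clause.head_mem_atoms (cl : Clause C Q) : cl.head ∈ cl.atoms := List.mem_cons_self

theorem Clause.atom_mem_atoms {cl : Clause C Q} {L : Literal C Q} (h : L ∈ cl.body) :
    L.atom ∈ cl.atoms :=
  List.mem_cons_of_mem _ (List.mem_map_of_mem h)

end FirstOrder

/-! ### Unification -/

section Unification

variable {C : Type u} {Q : Type v}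

/-- All constants among the values of `θ` belong to `K`. -/
def Subst.ConstsIn (K : Set C) (θ : Subst C) : Prop := ∀ x c, θ x = .const c → c ∈ K

theorem Term.mem_of_subst_eq_const {K : Set C} {θ : Subst C} (hθ : θ.ConstsIn K) {t : Term C}
    (ht : ∀ c, t = .const c → c ∈ K) (c : C) (h : t.subst θ = .const c) : c ∈ K := by
  cases t with
  | var x => exact hθ x c h
  | const d => exact ht c h

theorem Subst.ConstsIn.comp {K : Set C} {θ η : Subst C} (hθ : θ.ConstsIn K)
    (hη : η.ConstsIn K) : (θ.comp η).ConstsIn K :=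
  fun x c h => Term.mem_of_subst_eq_const hη (hθ x) c h

theorem Subst.constsIn_single {K : Set C} (x : ℕ) {t : Term C}
    (ht : ∀ c, t = .const c → c ∈ K) : (Subst.single x t).ConstsIn K := by
  intro y c h
  unfold Subst.single at h
  split_ifs at h
  exact ht c h

theorem Subst.single_self_subst (x : ℕ) (t : Term C) :
    t.subst (Subst.single x t) = t := by
  cases t with
  | var y =>
    simp only [Term.subst, Subst.single]
    split_ifs <;> rfl
  | const c => rfl

theorem Subst.single_comp {x : ℕ} {t : Term C} {δ : Subst C} (h : δ x = t.subst δ) :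
    (Subst.single x t).comp δ = δ := by
  funext y
  unfold Subst.comp Subst.single
  split_ifs with hy
  · rw [hy, h]
  · rfl

variable [DecidableEq C] [DecidableEq Q]

theorem unify_sound (l : List (Term C × Term C)) :
    ∀ {θ μ : Subst C}, unify θ l = some μ →
      (∃ η, μ = θ.comp η) ∧ ∀ p ∈ l, p.1.subst μ = p.2.subst μ := by
  induction l with
  | nil =>
    intro θ μ h
    simp only [unify, Option.some.injEq] at h
    refine ⟨⟨Term.var, ?_⟩, by simp⟩
    funext x
    rw [← h]
    exact (Term.subst_var _).symm
  | cons p r ih =>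
    obtain ⟨s, t⟩ := p
    intro θ μ h
    -- one elimination step: both sides agree under any specialization of the new substitution
    have key : ∀ x t', (s.subst θ).subst (Subst.single x t') = (t.subst θ).subst
        (Subst.single x t') → unify (θ.comp (Subst.single x t')) r = some μ →
        (∃ η, μ = θ.comp η) ∧ ∀ p ∈ (s, t) :: r, p.1.subst μ = p.2.subst μ := by
      intro x t' heq hu
      obtain ⟨⟨η, hη⟩, hr⟩ := ih hu
      refine ⟨⟨(Subst.single x t').comp η, by rw [hη, Subst.comp_assoc]⟩, ?_⟩
      intro p hp
      rcases List.mem_cons.1 hp with rfl | hp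
      · simp only [hη, Term.subst_comp, heq]
      · exact hr p hp
    unfold unify at h
    split at h
    · next c d hs ht =>
      split_ifs at h with hcd
      obtain ⟨⟨η, hη⟩, hr⟩ := ih h
      refine ⟨⟨η, hη⟩, ?_⟩
      intro p hp
      rcases List.mem_cons.1 hp with rfl | hp
      · simp only [hη, Term.subst_comp, hs, ht, hcd]
      · exact hr p hp
    · next x hs =>
      refine key x _ ?_ h
      rw [hs, Subst.single_self_subst]
      simp [Term.subst, Subst.single]
    · next c y hs ht =>
      refine key y _ ?_ h
      rw [hs, ht]
      simp [Term.subst, Subst.single]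

/-- Every unifier `δ` extending `θ` factors through the result of unification, by `δ` itself. -/
theorem unify_complete (l : List (Term C × Term C)) {δ : Subst C} :
    ∀ {θ : Subst C}, θ.comp δ = δ → (∀ p ∈ l, p.1.subst δ = p.2.subst δ) →
      ∃ μ, unify θ l = some μ ∧ μ.comp δ = δ := by
  induction l with
  | nil => exact fun {θ} hθ _ => ⟨θ, rfl, hθ⟩
  | cons p r ih =>
    obtain ⟨s, t⟩ := p
    intro θ hθ h
    have hst : (s.subst θ).subst δ = (t.subst θ).subst δ := by
      rw [← Term.subst_comp, ← Term.subst_comp, hθ]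
      exact h _ List.mem_cons_self
    have hr : ∀ p ∈ r, p.1.subst δ = p.2.subst δ := fun p hp => h p (List.mem_cons_of_mem _ hp)
    unfold unify
    split
    · next c d hs ht =>
      rw [hs, ht] at hst
      simp only [Term.subst, Term.const.injEq] at hst
      rw [if_pos hst]
      exact ih hθ hr
    · next x hs =>
      rw [hs] at hst
      refine ih ?_ hr
      rw [Subst.comp_assoc, Subst.single_comp hst, hθ]
    · next c y hs ht =>
      rw [hs, ht] at hst
      refine ih ?_ hr
      rw [Subst.comp_assoc, Subst.single_comp hst.symm, hθ]

theorem unify_constsIn {K : Set C} (l : List (Term C × Term C))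
    (hl : ∀ p ∈ l, (∀ c, p.1 = .const c → c ∈ K) ∧ ∀ c, p.2 = .const c → c ∈ K) :
    ∀ {θ μ : Subst C}, θ.ConstsIn K → unify θ l = some μ → μ.ConstsIn K := by
  induction l with
  | nil =>
    intro θ μ hθ h
    simp only [unify, Option.some.injEq] at h
    exact h ▸ hθ
  | cons p r ih =>
    obtain ⟨s, t⟩ := p
    intro θ μ hθ h
    have hr := @ih fun p hp => hl p (List.mem_cons_of_mem _ hp)
    have hs' := (hl _ List.mem_cons_self).1
    have ht' := (hl _ List.mem_cons_self).2
    unfold unify at h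
    split at h
    · split_ifs at h
      exact hr hθ h
    · exact hr (hθ.comp (Subst.constsIn_single _ (Term.mem_of_subst_eq_const hθ ht'))) h
    · next c y hs ht =>
      refine hr (hθ.comp (Subst.constsIn_single _ ?_)) h
      exact fun d hd => Term.mem_of_subst_eq_const hθ hs' d (hs.trans hd)

theorem zip_map_eq {α β : Type*} {f g : α → β} {l l' : List α} (hlen : l.length = l'.length)
    (h : ∀ p ∈ l.zip l', f p.1 = g p.2) : l.map f = l'.map g := by
  refine List.ext_getElem (by simpa using hlen) fun i h1 h2 => ?_
  simp only [List.length_map] at h1 h2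
  simp only [List.getElem_map]
  refine h (l[i], l'[i]) ?_
  rw [List.mem_iff_getElem]
  exact ⟨i, by simp [h1, h2], by simp⟩

theorem mguApart_sound {a b : Atom C Q} {μ : Subst C} (h : mguApart a b = some μ) :
    Inst (a.subst μ) b := by
  unfold mguApart at h
  split_ifs at h with hsym
  simp only [Option.map_eq_some_iff] at h
  obtain ⟨ν, hν, rfl⟩ := h
  have hu := (unify_sound _ hν).2
  simp only [Atom.sym, Prod.mk.injEq] at hsym
  refine ⟨fun x => ν (2 * x + 1), ?_⟩
  simp only [Atom.subst, Atom.mk.injEq, hsym.1, true_and]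
  refine zip_map_eq hsym.2 fun p hp => ?_
  have := hu (p.1.subst fun x => .var (2 * x), p.2.subst fun x => .var (2 * x + 1)) (by
    rw [List.zip_map]
    exact List.mem_map.2 ⟨p, hp, rfl⟩)
  simp only [← Term.subst_comp] at this
  exact this

theorem mguApart_constsIn {K : Set C} {a b : Atom C Q} {μ : Subst C}
    (h : mguApart a b = some μ) (ha : ∀ c ∈ a.consts, c ∈ K) (hb : ∀ c ∈ b.consts, c ∈ K) :
    μ.ConstsIn K := by
  unfold mguApart at h
  split_ifs at h with hsym
  simp only [Option.map_eq_some_iff] at h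
  obtain ⟨ν, hν, rfl⟩ := h
  have hν' : ν.ConstsIn K := by
    refine unify_constsIn _ ?_ (fun x c hx => by cases hx) hν
    rintro ⟨s, t⟩ hp
    have h1 := (List.of_mem_zip hp).1
    have h2 := (List.of_mem_zip hp).2
    simp only [List.mem_map] at h1 h2
    obtain ⟨s, hs, rfl⟩ := h1
    obtain ⟨t, ht, rfl⟩ := h2
    constructor
    · intro c hc
      cases s with
      | var x => cases hc
      | const d => exact ha c (Atom.mem_consts.2 (hc ▸ hs))
    · intro c hc
      cases t with
      | var x => cases hc
      | const d => exact hb c (Atom.mem_consts.2 (hc ▸ ht))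
  exact fun x => hν' (2 * x)

/-- If `a γ` is an instance of `b`, then `a` and `b` unify, and `γ` factors through the most general
unifier. -/
theorem mguApart_complete {a b : Atom C Q} {γ : Subst C} (h : Inst (a.subst γ) b) :
    ∃ μ η, mguApart a b = some μ ∧ μ.comp η = γ := by
  have hsym : a.sym = b.sym := (a.sym_subst γ).symm.trans h.sym_eq
  obtain ⟨ρ, hρ⟩ := h
  -- the two substitutions act jointly on the disjoint copies of the variables
  let δ : Subst C := fun n => if n % 2 = 0 then γ (n / 2) else ρ (n / 2)
  have hδ0 : ∀ x, δ (2 * x) = γ x := fun x => by simp [δ]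
  have hδ1 : ∀ x, δ (2 * x + 1) = ρ x := fun x => by
    have h1 : (2 * x + 1) % 2 ≠ 0 := by omega
    have h2 : (2 * x + 1) / 2 = x := by omega
    simp [δ, h2]
  obtain ⟨ν, hν, hνδ⟩ := unify_complete (δ := δ) (θ := Term.var) (List.zip
      (a.args.map (Term.subst fun x => .var (2 * x)))
      (b.args.map (Term.subst fun x => .var (2 * x + 1)))) rfl (by
    intro p hp
    rw [List.zip_map, List.mem_map] at hp
    obtain ⟨⟨s, t⟩, hst, rfl⟩ := hp
    simp only [Prod.map_fst, Prod.map_snd, ← Term.subst_comp]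
    have e0 : Subst.comp (fun x => Term.var (2 * x)) δ = γ := funext hδ0
    have e1 : Subst.comp (fun x => Term.var (2 * x + 1)) δ = ρ := funext hδ1
    rw [e0, e1]
    simp only [Atom.subst, Atom.mk.injEq] at hρ
    obtain ⟨i, hi, he⟩ := List.mem_iff_getElem.1 hst
    simp only [List.length_zip, lt_min_iff] at hi
    simp only [List.getElem_zip, Prod.mk.injEq] at he
    have := congrArg (fun l => l[i]?) hρ.2
    simpa [hi.1, hi.2, he.1, he.2] using this)
  refine ⟨fun x => ν (2 * x), δ, ?_, ?_⟩
  · simp only [mguApart, if_pos hsym, hν, Option.map_some]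
  · funext x
    exact (congrFun hνδ (2 * x)).trans (hδ0 x)

end Unification

/-! ### The Herbrand base and the well-founded model -/

section WellFoundedSemantics

variable {C : Type u} {Q : Type v} [Inhabited C] {P : Program C Q}

theorem constsOf_subset_HU (P : Program C Q) : constsOf P ⊆ HU P := by
  intro c hc
  unfold HU
  rw [if_pos ⟨c, hc⟩]
  exact hc

theorem HU_nonempty (P : Program C Q) : (HU P).Nonempty := by
  unfold HU
  split_ifs with h
  · exact h
  · exact Set.singleton_nonempty _

theorem consts_subst_subset_HU {cl : Clause C Q} (hcl : cl ∈ P) {a : Atom C Q}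
    (ha : a ∈ cl.atoms) {θ : Subst C} (hθ : θ.ConstsIn (HU P)) {c : C}
    (hc : c ∈ (a.subst θ).consts) : c ∈ HU P := by
  rcases Atom.mem_consts_subst hc with h | ⟨x, -, hx⟩
  · exact constsOf_subset_HU P ⟨cl, hcl, a, ha, h⟩
  · exact hθ x c hx

theorem constsIn_groundSubst {σ : ℕ → C} (hσ : ∀ x, σ x ∈ HU P) :
    (groundSubst σ).ConstsIn (HU P) := by
  intro x c h
  simp only [groundSubst, Term.const.injEq] at h
  exact h ▸ hσ x

theorem subst_mem_HB {cl : Clause C Q} (hcl : cl ∈ P) {a : Atom C Q} (ha : a ∈ cl.atoms)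
    {σ : ℕ → C} (hσ : ∀ x, σ x ∈ HU P) : a.subst (groundSubst σ) ∈ HB P :=
  ⟨a.isGround_groundSubst σ, ⟨cl, hcl, a, ha, (a.sym_subst _).symm⟩,
    fun _ hc => consts_subst_subset_HU hcl ha (constsIn_groundSubst hσ) hc⟩

/-- An atom of the Herbrand base is an instance of `h` by a substitution into the Herbrand
universe. -/
theorem exists_groundSubst {g h : Atom C Q} (hg : g ∈ HB P) (hi : Inst g h) :
    ∃ τ : ℕ → C, (∀ x, τ x ∈ HU P) ∧ g = h.subst (groundSubst τ) := by
  classical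
  obtain ⟨ρ, rfl⟩ := hi
  obtain ⟨e, he⟩ := HU_nonempty P
  refine ⟨fun x => if hx : ∃ c ∈ HU P, ρ x = .const c then hx.choose else e, ?_, ?_⟩
  · intro x
    dsimp only
    split_ifs with hx
    · exact hx.choose_spec.1
    · exact he
  · refine Atom.subst_congr fun x hx => ?_
    obtain ⟨c, hc, hcx⟩ := Atom.exists_const_of_isGround_subst hg.1 hx
    have hx' : ∃ c ∈ HU P, ρ x = .const c := ⟨c, hg.2.2 c hc, hcx⟩
    simp only [groundSubst, dif_pos hx']
    exact hx'.choose_spec.2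

theorem exists_comp_groundSubst {θ : Subst C} (hθ : θ.ConstsIn (HU P)) {τ : ℕ → C}
    (hτ : ∀ x, τ x ∈ HU P) :
    ∃ σ : ℕ → C, (∀ x, σ x ∈ HU P) ∧ θ.comp (groundSubst τ) = groundSubst σ := by
  have : ∀ x, ∃ c ∈ HU P, (θ x).subst (groundSubst τ) = .const c := by
    intro x
    cases h : θ x with
    | var y => exact ⟨τ y, hτ y, rfl⟩
    | const c => exact ⟨c, hθ x c h, rfl⟩
  choose σ hσ h using this
  exact ⟨σ, hσ, funext h⟩

theorem mem_true_of_body {c : Clause C Q} (hc : c ∈ P) {σ : ℕ → C} (hσ : ∀ x, σ x ∈ HU P)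
    (h : ∀ L ∈ c.body, LitTrue (wellFoundedModel P) (L.subst (groundSubst σ))) :
    c.head.subst (groundSubst σ) ∈ (wellFoundedModel P).1 := by
  have hfix : wfOperator P (wellFoundedModel P) = wellFoundedModel P := (wfOperator P).map_lfp
  rw [← hfix]
  refine ⟨_, ⟨c, hc, σ, hσ, rfl⟩, rfl, fun L hL => ?_⟩
  simp only [Clause.subst, List.mem_map] at hL
  obtain ⟨L, hL, rfl⟩ := hL
  exact h L hL

theorem subset_false_of_isUnfounded {U : Set (Atom C Q)}
    (h : IsUnfounded P (wellFoundedModel P) U) : U ⊆ (wellFoundedModel P).2 := by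
  have hfix : wfOperator P (wellFoundedModel P) = wellFoundedModel P := (wfOperator P).map_lfp
  rw [← hfix]
  exact fun a ha => ⟨U, h, ha⟩

theorem IsUnfounded.mono {I J : PartialInterp C Q} (hIJ : I ≤ J) {U : Set (Atom C Q)}
    (h : IsUnfounded P I U) : IsUnfounded P J U :=
  ⟨h.1, fun a ha g hg hga =>
    let ⟨L, hL, hf⟩ := h.2 a ha g hg hga
    ⟨L, hL, hf.imp (fun h' => h'.mono hIJ) id⟩⟩

/-- The well-founded model is consistent: no atom is both true and false. Its true and its false
part are shown to be disjoint from the approximations of the respective other part; for an unfounded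
set `U` of an approximation, a nested induction shows that no true atom ever enters `U`. -/
theorem wellFoundedModel_consistent (P : Program C Q) {a : Atom C Q}
    (ht : a ∈ (wellFoundedModel P).1) (hf : a ∈ (wellFoundedModel P).2) : False := by
  set M := wellFoundedModel P with hM
  have hfix : wfOperator P M = M := (wfOperator P).map_lfp
  have key : (∀ a ∈ M.1, a ∉ M.2) ∧ ∀ a ∈ M.2, a ∉ M.1 := by
    refine OrderHom.lfp_induction (wfOperator P)
      (p := fun I => (∀ a ∈ I.1, a ∉ M.2) ∧ ∀ a ∈ I.2, a ∉ M.1) ?_ ?_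
    · rintro I ⟨h1, h2⟩ hIM
      constructor
      · rintro a ⟨g, hg, rfl, hb⟩ hgf
        rw [← hfix] at hgf
        obtain ⟨U, hU, hgU⟩ := hgf
        have hUM : U ⊆ M.2 := subset_false_of_isUnfounded hU
        obtain ⟨L, hL, hLf⟩ := hU.2 _ hgU g hg rfl
        have hLt := hb L hL
        rcases hLf with hLf | ⟨b, hbU, rfl⟩
        · cases L with
          | pos b => exact h1 b hLt hLf
          | neg b => exact h2 b hLt hLf
        · exact h1 b hLt (hUM hbU)
      · rintro a ⟨U, hU, haU⟩ haM
        have : ∀ b ∈ M.1, b ∉ U := by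
          refine OrderHom.lfp_induction (wfOperator P) (p := fun J => ∀ b ∈ J.1, b ∉ U) ?_ ?_
          · rintro J hJ hJM b ⟨g, hg, rfl, hb⟩ hgU
            obtain ⟨L, hL, hLf⟩ := hU.2 _ hgU g hg rfl
            have hLt := hb L hL
            rcases hLf with hLf | ⟨b, hbU, rfl⟩
            · cases L with
              | pos b => exact h2 b hLf (hJM.1 hLt)
              | neg b => exact h1 b hLf (hJM.2 hLt)
            · exact hJ b hLt hbU
          · intro s hs b hb
            rw [Prod.fst_sSup] at hb
            simp only [Set.sSup_eq_sUnion, Set.mem_sUnion, Set.mem_image] at hb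
            obtain ⟨_, ⟨J, hJ, rfl⟩, hb⟩ := hb
            exact hs J hJ b hb
        exact this a haM haU
    · intro s hs
      constructor
      · intro b hb
        rw [Prod.fst_sSup] at hb
        simp only [Set.sSup_eq_sUnion, Set.mem_sUnion, Set.mem_image] at hb
        obtain ⟨_, ⟨J, hJ, rfl⟩, hb⟩ := hb
        exact (hs J hJ).1 b hb
      · intro b hb
        rw [Prod.snd_sSup] at hb
        simp only [Set.sSup_eq_sUnion, Set.mem_sUnion, Set.mem_image] at hb
        obtain ⟨_, ⟨J, hJ, rfl⟩, hb⟩ := hb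
        exact (hs J hJ).2 b hb
  exact key.1 a ht hf

end WellFoundedSemantics

/-! ### SLG steps as extensions of the forest -/

section SLG

variable {C : Type u} {Q : Type v}

theorem ComputationRule.pick_nil (R : ComputationRule C Q) : R.pick [] = none := by
  simp [ComputationRule.pick]

theorem ComputationRule.exists_pick (R : ComputationRule C Q) {gs : List (Literal C Q)}
    (h : gs ≠ []) : ∃ L rest, R.pick gs = some (L, rest) := by
  simp [ComputationRule.pick, R.select_lt gs h]

theorem ComputationRule.pick_spec {R : ComputationRule C Q} {gs rest : List (Literal C Q)}
    {L : Literal C Q} (h : R.pick gs = some (L, rest)) :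
    (∀ L', L' ∈ gs ↔ L' = L ∨ L' ∈ rest) ∧ gs.length = rest.length + 1 := by
  simp only [ComputationRule.pick, Option.map_eq_some_iff, Prod.mk.injEq] at h
  obtain ⟨L', hL', rfl, rfl⟩ := h
  obtain ⟨hlt, rfl⟩ := List.getElem?_eq_some_iff.1 hL'
  have hp := List.getElem_cons_eraseIdx_perm hlt
  constructor
  · intro L'
    rw [← hp.mem_iff, List.mem_cons]
  · rw [← hp.length_eq, List.length_cons]

variable [DecidableEq C] [DecidableEq Q]
variable {P : Program C Q} {R : ComputationRule C Q} {F F' : Forest C Q}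

theorem label_nil (S : Atom C Q) : label P R S [] = none := rfl

theorem label_fail (S : Atom C Q) (b : Branch C Q) : label P R S (.fail :: b) = none := rfl

theorem label_clause {S : Atom C Q} {k : ℕ} {b : Branch C Q} {N : Label C Q}
    (h : label P R S (.clause k :: b) = some N) :
    ∃ c θ, P[k]? = some c ∧ mguApart c.head S = some θ ∧ b = [] ∧
      N = ⟨k, θ, c.head.subst θ, c.body.map (Literal.subst θ), []⟩ := by
  cases b with
  | nil =>
    simp only [label, Option.bind_eq_some_iff, Option.map_eq_some_iff] at h
    obtain ⟨c, hc, θ, hθ, rfl⟩ := h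
    exact ⟨c, θ, hc, hθ, rfl, rfl⟩
  | cons e b => simp [label] at h

theorem label_answer {S a h : Atom C Q} {f : Bool} {b : Branch C Q} {N : Label C Q}
    {rest : List (Literal C Q)} (hN : label P R S b = some N)
    (hp : R.pick N.goals = some (.pos a, rest)) :
    label P R S (.answer h f :: b) = (mguApart a h).map fun μ =>
      ⟨N.clause, N.subst.comp μ, N.head.subst μ, rest.map (Literal.subst μ),
        if f then .pos a.norm h :: N.delays else N.delays⟩ := by
  rw [label, hN, Option.bind_some]
  simp only [hp]

theorem label_negSuccess {S a : Atom C Q} {b : Branch C Q} {N : Label C Q}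
    {rest : List (Literal C Q)} (hN : label P R S b = some N)
    (hp : R.pick N.goals = some (.neg a, rest)) :
    label P R S (.negSuccess :: b) = some { N with goals := rest } := by
  rw [label, hN, Option.bind_some]
  simp only [hp]

theorem label_delay {S a : Atom C Q} {b : Branch C Q} {N : Label C Q}
    {rest : List (Literal C Q)} (hN : label P R S b = some N)
    (hp : R.pick N.goals = some (.neg a, rest)) :
    label P R S (.delay :: b) =
      some { N with goals := rest, delays := .neg a :: N.delays } := by
  rw [label, hN, Option.bind_some]
  simp only [hp]

theorem label_simplify {S : Atom C Q} {b : Branch C Q} {N : Label C Q} {d : Delayed C Q}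
    (hN : label P R S b = some N) :
    label P R S (.simplify d :: b) =
      some { N with delays := N.delays.filter (· ≠ d) } := by
  rw [label, hN, Option.map_some]

theorem isSome_label_answer_iff {S h : Atom C Q} {f f' : Bool} {b : Branch C Q} :
    (label P R S (.answer h f :: b)).isSome ↔ (label P R S (.answer h f' :: b)).isSome := by
  simp only [label]
  cases label P R S b with
  | none => simp
  | some N =>
    simp only [Option.bind_some]
    split <;> simp

namespace Forest

theorem Selects.ne_nil {S : Atom C Q} {b : Branch C Q} {N N' : Label C Q} {L : Literal C Q}
    (h : F.Selects P R S b N L) (hN : label P R S b = some N') : N'.goals ≠ [] := by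
  obtain ⟨-, h1, rest, h2⟩ := h
  rw [h1, Option.some.injEq] at hN
  subst hN
  intro h0
  rw [h0, R.pick_nil] at h2
  exact absurd h2 (by simp)

theorem Selects.unique {S : Atom C Q} {b : Branch C Q} {N N' : Label C Q} {L L' : Literal C Q}
    (h : F.Selects P R S b N L) (h' : F'.Selects P R S b N' L') : N = N' ∧ L = L' := by
  obtain ⟨-, h1, rest, h2⟩ := h
  obtain ⟨-, h1', rest', h2'⟩ := h'
  rw [h1, Option.some.injEq] at h1'
  subst h1'
  rw [h2, Option.some.injEq, Prod.mk.injEq] at h2'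
  exact ⟨rfl, h2'.1⟩

theorem Selects.not_nil {S : Atom C Q} {N : Label C Q} {L : Literal C Q}
    (h : F.Selects P R S [] N L) : False := by
  have := h.2.1
  simp [label_nil] at this

theorem supported_iff {S h : Atom C Q} :
    F.Supported P R S h ↔ S ∉ F.completed ∨ ∃ b N, F.IsAnswer P R S b N ∧ N.head.norm = h ∧
      ∀ S' h', Delayed.pos S' h' ∈ N.delays → F.Supported P R S' h' := by
  constructor
  · intro hs
    cases hs with
    | incomplete _ _ hS => exact .inl hS
    | answer _ b N hA hd => exact .inr ⟨b, N, hA, rfl, hd⟩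
  · rintro (hS | ⟨b, N, hA, rfl, hd⟩)
    · exact .incomplete S h hS
    · exact .answer S b N hA hd

theorem HasUnconditional.supported {S h : Atom C Q} (hu : F.HasUnconditional P R S h) :
    F.Supported P R S h := by
  obtain ⟨b, N, hA, hd, rfl⟩ := hu
  refine .answer S b N hA fun S' h' hm => ?_
  simp [hd] at hm

theorem HasUnconditional.hasAnswer {S h : Atom C Q} (hu : F.HasUnconditional P R S h) :
    F.HasAnswer P R S h := by
  obtain ⟨b, N, hA, -, rfl⟩ := hu
  exact ⟨b, N, hA, rfl⟩

/-- The reasons for failing a node on account of one of its delayed literals. For positive delayed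
literals they subsume both simplification and answer completion. -/
def Refutes (P : Program C Q) (R : ComputationRule C Q) (F : Forest C Q) : Delayed C Q → Prop
  | .neg a => F.HasUnconditional P R a a
  | .pos S h => ¬ F.Supported P R S h

theorem Fails.refutes {d : Delayed C Q} (h : F.Fails P R d) : F.Refutes P R d := by
  cases d with
  | neg a => exact h
  | pos S a =>
    intro hs
    rcases supported_iff.1 hs with hs | ⟨b, N, hA, hN, -⟩
    · exact hs h.1
    · exact h.2 ⟨b, N, hA, hN⟩

/-- The conditions under which an SLG operation adds the edge `e` below the node `b` of the tree for
`S`. -/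
def CanExtend (P : Program C Q) (R : ComputationRule C Q) (F : Forest C Q) (S : Atom C Q)
    (b : Branch C Q) : Edge C Q → Prop
  | .clause k => b = [] ∧ (label P R S [.clause k]).isSome
  | .answer h f => (∃ N a, F.Selects P R S b N (.pos a) ∧ F.HasAnswer P R a.norm h ∧
      (f = false → F.HasUnconditional P R a.norm h)) ∧
      (label P R S (.answer h false :: b)).isSome ∧ ∀ f', (S, .answer h f' :: b) ∉ F.nodes
  | .negSuccess => F.IsLeaf S b ∧ ∃ N a, F.Selects P R S b N (.neg a) ∧ a.IsGround ∧
      F.Succeeds P R (.neg a)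
  | .delay => F.IsLeaf S b ∧ ∃ N a, F.Selects P R S b N (.neg a) ∧ a.IsGround ∧ F.HasTree a
  | .simplify d => ∃ N, F.IsAnswer P R S b N ∧ d ∈ N.delays ∧ F.Succeeds P R d
  | .fail => (F.IsLeaf S b ∧ ∃ N a, F.Selects P R S b N (.neg a) ∧ a.IsGround ∧
      F.HasUnconditional P R a a) ∨
      ∃ N, F.IsAnswer P R S b N ∧ ∃ d ∈ N.delays, F.Refutes P R d

end Forest

open Forest

/-- An SLG operation adds the root of a tree, or adds a child to a node, or completes a set of
subgoals. -/
theorem SLGStep.cases_nodes (h : SLGStep P R F F') :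
    (∃ S b N L, F.Selects P R S b N L ∧ ¬ F.HasTree L.atom.norm ∧
      F' = F.addNode L.atom.norm []) ∨
    (∃ S b e, (S, b) ∈ F.nodes ∧ (S, e :: b) ∉ F.nodes ∧ F.CanExtend P R S b e ∧
      F' = F.addNode S (e :: b)) ∨
    ∃ G : Set (Atom C Q), G.Nonempty ∧ Disjoint G F.completed ∧ F.CompletelyEvaluated P R G ∧
      F' = ⟨F.nodes, F.completed ∪ G⟩ := by
  cases h with
  | newSubgoal S b N L h1 h2 h3 => exact .inl ⟨S, b, N, L, h1, h3, rfl⟩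
  | programClause S k h1 h2 h3 => exact .inr (.inl ⟨S, [], .clause k, h1, h3, ⟨rfl, h2⟩, rfl⟩)
  | positiveReturn S b N a h h1 h2 h3 h4 =>
    exact .inr (.inl ⟨S, b, .answer h false, h1.1, h4 _,
      ⟨⟨N, a, h1, h2.hasAnswer, fun _ => h2⟩, h3, h4⟩, rfl⟩)
  | positiveDelay S b N a h h1 h2 h2' h3 h4 =>
    exact .inr (.inl ⟨S, b, .answer h true, h1.1, h4 _, ⟨⟨N, a, h1, h2, fun h => by cases h⟩,
      isSome_label_answer_iff.1 h3, h4⟩, rfl⟩)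
  | negationSuccess S b N a h1 h2 h3 h4 =>
    exact .inr (.inl ⟨S, b, .negSuccess, h1.1, h2.2 _, ⟨h2, N, a, h1, h3, h4⟩, rfl⟩)
  | negationFailure S b N a h1 h2 h3 h4 =>
    exact .inr (.inl ⟨S, b, .fail, h1.1, h2.2 _, Or.inl ⟨h2, N, a, h1, h3, h4⟩, rfl⟩)
  | delaying S b N a h1 h2 h3 h4 h5 h6 =>
    exact .inr (.inl ⟨S, b, .delay, h1.1, h2.2 _, ⟨h2, N, a, h1, h3, h4⟩, rfl⟩)
  | simplifySuccess S b N d h1 h2 h3 =>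
    exact .inr (.inl ⟨S, b, .simplify d, h1.1.1, h1.1.2 _, ⟨N, h1, h2, h3⟩, rfl⟩)
  | simplifyFailure S b N d h1 h2 h3 =>
    exact .inr (.inl ⟨S, b, .fail, h1.1.1, h1.1.2 _, Or.inr ⟨N, h1, d, h2, h3.refutes⟩, rfl⟩)
  | completion G h1 h2 h3 => exact .inr (.inr ⟨G, h1, h2, h3, rfl⟩)
  | answerCompletion S b N h1 h2 =>
    refine .inr (.inl ⟨S, b, .fail, h1.1.1, h1.1.2 _, Or.inr ⟨N, h1, ?_⟩, rfl⟩)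
    by_contra hcon
    push Not at hcon
    refine h2 (.answer S b N h1 fun S' h' hm => ?_)
    have := hcon _ hm
    simp only [Refutes, not_not] at this
    exact this

theorem SLGStep.nodes_subset (h : SLGStep P R F F') : F.nodes ⊆ F'.nodes := by
  rcases h.cases_nodes with ⟨S, b, N, L, -, -, rfl⟩ | ⟨S, b, e, -, -, -, rfl⟩ | ⟨G, -, -, -, rfl⟩
  · exact Set.subset_insert _ _
  · exact Set.subset_insert _ _
  · exact subset_rfl

theorem SLGStep.completed_subset (h : SLGStep P R F F') : F.completed ⊆ F'.completed := by
  rcases h.cases_nodes with ⟨S, b, N, L, -, -, rfl⟩ | ⟨S, b, e, -, -, -, rfl⟩ | ⟨G, -, -, -, rfl⟩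
  · exact subset_rfl
  · exact subset_rfl
  · exact Set.subset_union_left

namespace Forest

/-- In a completely evaluated tree only answer nodes are extended, by simplification and
failure. -/
theorem CanExtend.of_completed (hce : F.CompletelyEvaluated P R F.completed) {S : Atom C Q}
    (hS : S ∈ F.completed) {b : Branch C Q} {e : Edge C Q} (he : (S, e :: b) ∉ F.nodes)
    (h : F.CanExtend P R S b e) : ∃ N, F.IsAnswer P R S b N ∧
      (e = .fail ∨ ∃ d ∈ N.delays, F.Succeeds P R d ∧ e = .simplify d) := by
  obtain ⟨-, hcl, hsel⟩ := hce S hS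
  have hneg : ∀ N a, F.IsLeaf S b → F.Selects P R S b N (.neg a) → False := by
    intro N a hl hs
    obtain ⟨-, e, he⟩ := hsel b N _ hs
    exact hl.2 e he
  cases e with
  | clause k =>
    obtain ⟨rfl, hk⟩ := h
    exact absurd (hcl k hk) he
  | answer h' f =>
    obtain ⟨⟨N, a, hs, ha, -⟩, hl, hn⟩ := h
    obtain ⟨f', hf'⟩ := (hsel b N _ hs).2 h' ha hl
    exact absurd hf' (hn f')
  | negSuccess =>
    obtain ⟨hl, N, a, hs, -⟩ := h
    exact (hneg N a hl hs).elim
  | delay =>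
    obtain ⟨hl, N, a, hs, -⟩ := h
    exact (hneg N a hl hs).elim
  | simplify d =>
    obtain ⟨N, hA, hd, hs⟩ := h
    exact ⟨N, hA, .inr ⟨d, hd, hs, rfl⟩⟩
  | fail =>
    rcases h with ⟨hl, N, a, hs, -⟩ | ⟨N, hA, -⟩
    · exact (hneg N a hl hs).elim
    · exact ⟨N, hA, .inl rfl⟩

end Forest

/-! ### What an SLG step preserves -/

theorem SLGStep.isAnswer_of_mem (h : SLGStep P R F F') {S : Atom C Q} {b : Branch C Q}
    {N : Label C Q} (hA : F'.IsAnswer P R S b N) (hm : (S, b) ∈ F.nodes) :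
    F.IsAnswer P R S b N :=
  ⟨⟨hm, fun e he => hA.1.2 e (h.nodes_subset he)⟩, hA.2⟩

theorem SLGStep.hasUnconditional (h : SLGStep P R F F') {S a : Atom C Q}
    (hu : F.HasUnconditional P R S a) : F'.HasUnconditional P R S a := by
  obtain ⟨b, N, ⟨⟨hm, hl⟩, hN, hg⟩, hd, rfl⟩ := hu
  refine ⟨b, N, ⟨⟨h.nodes_subset hm, ?_⟩, hN, hg⟩, hd, rfl⟩
  intro e he
  rcases h.cases_nodes with ⟨S', b', N', L, -, -, rfl⟩ | ⟨S', b', e', h1, h2, h3, rfl⟩ |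
    ⟨G, -, -, -, rfl⟩
  · rcases he with he | he
    · simp at he
    · exact hl e he
  · rcases he with he | he
    · simp only [Prod.mk.injEq, List.cons.injEq] at he
      obtain ⟨rfl, rfl, rfl⟩ := he
      cases e with
      | clause k =>
        obtain ⟨rfl, -⟩ := h3
        simp [label_nil] at hN
      | answer h' f =>
        obtain ⟨⟨N', a, hs, -⟩, -⟩ := h3
        exact hs.ne_nil hN hg
      | negSuccess =>
        obtain ⟨-, N', a, hs, -⟩ := h3
        exact hs.ne_nil hN hg
      | delay =>
        obtain ⟨-, N', a, hs, -⟩ := h3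
        exact hs.ne_nil hN hg
      | simplify d =>
        obtain ⟨N', hA, hd', -⟩ := h3
        have := hA.2.1.symm.trans hN
        simp only [Option.some.injEq] at this
        simp [this, hd] at hd'
      | fail =>
        rcases h3 with ⟨-, N', a, hs, -⟩ | ⟨N', hA, d, hd', -⟩
        · exact hs.ne_nil hN hg
        · have := hA.2.1.symm.trans hN
          simp only [Option.some.injEq] at this
          simp [this, hd] at hd'
    · exact hl e he
  · exact hl e he

/-- The new answer nodes of completed tables arise by simplification. -/
theorem SLGStep.isAnswer_of_completed (h : SLGStep P R F F')
    (hce : F.CompletelyEvaluated P R F.completed) {S : Atom C Q} (hS : S ∈ F.completed)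
    {b : Branch C Q} {N : Label C Q} (hA : F'.IsAnswer P R S b N) :
    F.IsAnswer P R S b N ∨ ∃ b₀ N₀ d, F.IsAnswer P R S b₀ N₀ ∧ d ∈ N₀.delays ∧
      F.Succeeds P R d ∧ N = { N₀ with delays := N₀.delays.filter (· ≠ d) } := by
  by_cases hm : (S, b) ∈ F.nodes
  · exact .inl (h.isAnswer_of_mem hA hm)
  have hm' := hA.1.1
  rcases h.cases_nodes with ⟨S', b', N', L, -, -, rfl⟩ | ⟨S', b', e', h1, h2, h3, rfl⟩ |
    ⟨G, -, -, -, rfl⟩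
  · rcases hm' with he | he
    · simp only [Prod.mk.injEq] at he
      obtain ⟨-, rfl⟩ := he
      have := hA.2.1
      simp [label_nil] at this
    · exact absurd he hm
  · rcases hm' with he | he
    · simp only [Prod.mk.injEq] at he
      obtain ⟨rfl, rfl⟩ := he
      obtain ⟨N₀, hA₀, rfl | ⟨d, hd, hs, rfl⟩⟩ := h3.of_completed hce hS h2
      · have := hA.2.1
        simp [label_fail] at this
      · refine .inr ⟨b', N₀, d, hA₀, hd, hs, ?_⟩
        have := hA.2.1
        rw [label_simplify hA₀.2.1, Option.some.injEq] at this
        exact this.symm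
    · exact absurd he hm
  · exact absurd hm' hm

theorem SLGStep.hasAnswer_of_completed (h : SLGStep P R F F')
    (hce : F.CompletelyEvaluated P R F.completed) {S a : Atom C Q} (hS : S ∈ F.completed)
    (hA : F'.HasAnswer P R S a) : F.HasAnswer P R S a := by
  obtain ⟨b, N, hA, rfl⟩ := hA
  rcases h.isAnswer_of_completed hce hS hA with hA | ⟨b₀, N₀, d, hA₀, -, -, rfl⟩
  · exact ⟨b, N, hA, rfl⟩
  · exact ⟨b₀, N₀, hA₀, rfl⟩

/-- Support is lost but never gained: in completed tables answers disappear or lose delayed literals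
that have unconditional answers, and in incomplete tables everything counts as supported. -/
theorem SLGStep.supported (h : SLGStep P R F F')
    (hce : F.CompletelyEvaluated P R F.completed) {S a : Atom C Q}
    (hs : F'.Supported P R S a) : F.Supported P R S a := by
  induction hs with
  | incomplete S a hS => exact .incomplete S a fun h' => hS (h.completed_subset h')
  | answer S b N hA hd ih =>
    by_cases hS : S ∈ F.completed
    · rcases h.isAnswer_of_completed hce hS hA with hA | ⟨b₀, N₀, d, hA₀, -, hsd, rfl⟩
      · exact .answer S b N hA ih
      · refine .answer S b₀ N₀ hA₀ fun S' h' hm => ?_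
        by_cases hd' : Delayed.pos S' h' = d
        · subst hd'
          exact HasUnconditional.supported hsd
        · exact ih S' h' (List.mem_filter.2 ⟨hm, by simpa using hd'⟩)
    · exact .incomplete S _ hS

theorem SLGStep.refutes (h : SLGStep P R F F')
    (hce : F.CompletelyEvaluated P R F.completed) {d : Delayed C Q} (hd : F.Refutes P R d) :
    F'.Refutes P R d := by
  cases d with
  | neg a => exact h.hasUnconditional hd
  | pos S a => exact fun hs => hd (h.supported hce hs)

/-- Completed tables remain completely evaluated: no goal is selected at their new nodes, and the
tables they consume are completed as well and get no new answers. -/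
theorem SLGStep.completelyEvaluated (h : SLGStep P R F F')
    (hce : F.CompletelyEvaluated P R F.completed) :
    F'.CompletelyEvaluated P R F'.completed := by
  have hsub := h.nodes_subset
  rcases h.cases_nodes with ⟨S', b', N', L', h1, h2, rfl⟩ | ⟨S', b', e', h1, h2, h3, rfl⟩ |
    ⟨G, hG1, hG2, hG3, rfl⟩
  · intro S hS
    obtain ⟨ht, hcl, hsel⟩ := hce S hS
    refine ⟨hsub ht, fun k hk => hsub (hcl k hk), fun b N L hs => ?_⟩
    have hs' : F.Selects P R S b N L := by
      refine ⟨?_, hs.2⟩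
      rcases hs.1 with he | he
      · simp only [Prod.mk.injEq] at he
        obtain ⟨-, rfl⟩ := he
        exact hs.not_nil.elim
      · exact he
    obtain ⟨⟨hT, hc⟩, hL⟩ := hsel b N L hs'
    refine ⟨⟨hsub hT, hc⟩, ?_⟩
    cases L with
    | pos a =>
      intro h' ha hl
      obtain ⟨f, hf⟩ := hL h' (h.hasAnswer_of_completed hce (hc.elim id id) ha) hl
      exact ⟨f, hsub hf⟩
    | neg a =>
      obtain ⟨e, he⟩ := hL
      exact ⟨e, hsub he⟩
  · intro S hS
    obtain ⟨ht, hcl, hsel⟩ := hce S hS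
    refine ⟨hsub ht, fun k hk => hsub (hcl k hk), fun b N L hs => ?_⟩
    have hs' : F.Selects P R S b N L := by
      refine ⟨?_, hs.2⟩
      rcases hs.1 with he | he
      · simp only [Prod.mk.injEq] at he
        obtain ⟨rfl, rfl⟩ := he
        obtain ⟨N₀, hA₀, rfl | ⟨d, hd, hsd, rfl⟩⟩ := h3.of_completed hce hS h2
        · have := hs.2.1
          simp [label_fail] at this
        · exact (hs.ne_nil (label_simplify hA₀.2.1) hA₀.2.2).elim
      · exact he
    obtain ⟨⟨hT, hc⟩, hL⟩ := hsel b N L hs'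
    refine ⟨⟨hsub hT, hc⟩, ?_⟩
    cases L with
    | pos a =>
      intro h' ha hl
      obtain ⟨f, hf⟩ := hL h' (h.hasAnswer_of_completed hce (hc.elim id id) ha) hl
      exact ⟨f, hsub hf⟩
    | neg a =>
      obtain ⟨e, he⟩ := hL
      exact ⟨e, hsub he⟩
  · intro S hS
    rcases hS with hS | hS
    · obtain ⟨ht, hcl, hsel⟩ := hce S hS
      refine ⟨ht, hcl, fun b N L hs => ?_⟩
      obtain ⟨⟨hT, hc⟩, hL⟩ := hsel b N L hs
      exact ⟨⟨hT, .inl (.inl (hc.elim id id))⟩, hL⟩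
    · obtain ⟨ht, hcl, hsel⟩ := hG3 S hS
      refine ⟨ht, hcl, fun b N L hs => ?_⟩
      obtain ⟨⟨hT, hc⟩, hL⟩ := hsel b N L hs
      exact ⟨⟨hT, .inl hc⟩, hL⟩

/-! ### Completion of all subgoals -/

/-- When no operation applies and the evaluation has not floundered, all subgoals are completed. -/
theorem Forest.mem_completed_of_hasTree (hterm : ∀ F', ¬ SLGStep P R F F')
    (hfl : ¬ F.Flounders P R) {S : Atom C Q} (hT : F.HasTree S) :
    S ∈ F.completed := by
  by_contra hS
  refine hterm _ (.completion F {T | F.HasTree T ∧ T ∉ F.completed} ⟨S, hT, hS⟩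
    (Set.disjoint_left.2 fun T hT => hT.2) ?_)
  rintro T ⟨hT, -⟩
  have hgr : ∀ {S b N a}, F.Selects P R S b N (.neg a) → a.IsGround := fun hs => by
    by_contra hcon
    exact hfl ⟨_, _, _, _, hs, hcon⟩
  have htree : ∀ {b N L}, F.Selects P R T b N L → F.HasTree L.atom.norm := fun hs => by
    by_contra hcon
    exact hterm _ (.newSubgoal F T _ _ _ hs (fun a ha => hgr (ha ▸ hs)) hcon)
  refine ⟨hT, ?_, ?_⟩
  · intro k hk
    by_contra hcon
    exact hterm _ (.programClause F T k hT hk hcon)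
  · intro b N L hs
    refine ⟨⟨htree hs, ?_⟩, ?_⟩
    · by_cases hc : L.atom.norm ∈ F.completed
      · exact .inl hc
      · exact .inr ⟨htree hs, hc⟩
    · cases L with
      | pos a =>
        intro h hh hl
        by_contra hcon
        push Not at hcon
        by_cases hu : F.HasUnconditional P R a.norm h
        · exact hterm _ (.positiveReturn F T b N a h hs hu hl hcon)
        · exact hterm _ (.positiveDelay F T b N a h hs hh hu (isSome_label_answer_iff.1 hl) hcon)
      | neg a =>
        by_contra hcon
        push Not at hcon
        have hleaf : F.IsLeaf T b := ⟨hs.1, hcon⟩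
        by_cases h1 : F.Succeeds P R (.neg a)
        · exact hterm _ (.negationSuccess F T b N a hs hleaf (hgr hs) h1)
        · by_cases h2 : F.Fails P R (.neg a)
          · exact hterm _ (.negationFailure F T b N a hs hleaf (hgr hs) h2)
          · have ht := htree hs
            rw [Literal.atom, (hgr hs).norm_eq] at ht
            exact hterm _ (.delaying F T b N a hs hleaf (hgr hs) ht h1 h2)

end SLG

/-! ### The invariant of SLG evaluations -/

section SLG

variable {C : Type u} {Q : Type v} {P : Program C Q}

/-- The atoms that occur in the subgoals and tables of an evaluation. Up to the renaming of
variables, which are positions in the argument list, they are the atoms in the language of the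
program; there are only finitely many of them. -/
structure InLanguage (P : Program C Q) (a : Atom C Q) : Prop where
  sym : ∃ cl ∈ P, ∃ b ∈ cl.atoms, b.sym = a.sym
  consts : ∀ c ∈ a.consts, c ∈ constsOf P
  vars : ∀ x ∈ a.vars, x < a.args.length

/-- The atoms of a delayed literal, including the subgoal whose table answers it, are in the
language. -/
def Delayed.InLanguage (P : Program C Q) : Delayed C Q → Prop
  | .neg a => BKB.InLanguage P a
  | .pos S h => BKB.InLanguage P S ∧ BKB.InLanguage P h

theorem InLanguage.norm_subst {cl : Clause C Q} (hcl : cl ∈ P) {a : Atom C Q}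
    (ha : a ∈ cl.atoms) {θ : Subst C} (hθ : θ.ConstsIn (constsOf P)) :
    InLanguage P (a.subst θ).norm where
  sym := ⟨cl, hcl, a, ha, ((inst_norm_left _).trans (inst_subst a θ)).sym_eq.symm⟩
  consts c hc := by
    rcases Atom.mem_consts_subst (Atom.mem_consts_norm hc) with h | ⟨x, -, hx⟩
    · exact ⟨cl, hcl, a, ha, h⟩
    · exact hθ x c hx
  vars _ := Atom.lt_of_mem_vars_norm

variable [Inhabited C]

theorem InLanguage.mem_HB {a : Atom C Q} (h : InLanguage P a) (hg : a.IsGround) : a ∈ HB P :=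
  ⟨hg, h.sym, fun c hc => constsOf_subset_HU P (h.consts c hc)⟩

/-- The instance `L` of a body literal has been resolved away soundly: it is true in the
well-founded model, or it depends on a delayed literal in `D`. A positive literal counts as true if
all its instances in the Herbrand base are. -/
def Justified (P : Program C Q) (D : List (Delayed C Q)) : Literal C Q → Prop
  | .pos a => (∀ g ∈ HB P, Inst g a → g ∈ (wellFoundedModel P).1) ∨
      ∃ S h, Delayed.pos S h ∈ D ∧ Inst a h
  | .neg a => a.IsGround ∧ (a ∈ (wellFoundedModel P).2 ∨ Delayed.neg a ∈ D)

theorem Justified.subst {D D' : List (Delayed C Q)} (hD : D ⊆ D') {L : Literal C Q}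
    (h : Justified P D L) (μ : Subst C) : Justified P D' (L.subst μ) := by
  cases L with
  | pos a =>
    rcases h with h | ⟨S, t, ht, hi⟩
    · exact .inl fun g hg hgi => h g hg (hgi.trans (inst_subst a μ))
    · exact .inr ⟨S, t, hD ht, (inst_subst a μ).trans hi⟩
  | neg a =>
    have : Literal.subst μ (.neg a) = .neg a := by rw [Literal.subst, h.1.subst_eq]
    rw [this]
    exact ⟨h.1, h.2.imp id fun h' => hD h'⟩

/-- The invariant for the label `N` of a node at depth `n` in the tree for `S`, whose root is
expanded by the clause `c`. `Gy` is a set of predicate symbols all of whose answers are ground. -/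
structure LabelSound (P : Program C Q) (Gy : Set (Pred C Q × ℕ)) (F : Forest C Q) (S : Atom C Q)
    (n : ℕ) (N : Label C Q) (c : Clause C Q) : Prop where
  clause : P[N.clause]? = some c
  head : N.head = c.head.subst N.subst
  inst : Inst N.head S
  consts : N.subst.ConstsIn (constsOf P)
  goals : ∀ L ∈ N.goals, ∃ L₀ ∈ c.body, L = L₀.subst N.subst
  body : ∀ L ∈ c.body, L.subst N.subst ∈ N.goals ∨ Justified P N.delays (L.subst N.subst)
  ground : ∀ a, Literal.pos a ∈ c.body → a.sym ∈ Gy →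
    Literal.pos (a.subst N.subst) ∈ N.goals ∨ (a.subst N.subst).IsGround
  delays_neg : ∀ a, Delayed.neg a ∈ N.delays → F.HasTree a ∧ a.IsGround
  delays_pos : ∀ T h, Delayed.pos T h ∈ N.delays → F.HasTree T ∧ InLanguage P h
  -- returning a conditional answer trades a goal for a delayed literal
  depth : n + 2 * N.goals.length + N.delays.length ≤ 1 + 2 * c.body.length

/-- Every head variable of a clause for a symbol in `Gy` occurs in a positive body literal with a
symbol in `Gy`, so that the answers of the tables for these symbols are ground. -/
def RangeRestricted (P : Program C Q) (Gy : Set (Pred C Q × ℕ)) : Prop :=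
  ∀ c ∈ P, c.head.sym ∈ Gy → ∀ x ∈ c.head.vars, ∃ a, Literal.pos a ∈ c.body ∧ a.sym ∈ Gy ∧
    x ∈ a.vars

variable {F F' : Forest C Q} {Gy : Set (Pred C Q × ℕ)} {S : Atom C Q} {n : ℕ} {N : Label C Q}
  {c : Clause C Q}

theorem LabelSound.clause_mem (h : LabelSound P Gy F S n N c) : c ∈ P :=
  List.mem_of_getElem? h.clause

theorem LabelSound.mono (h : LabelSound P Gy F S n N c) (hFF : F.nodes ⊆ F'.nodes) :
    LabelSound P Gy F' S n N c where
  __ := h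
  delays_neg a ha := ⟨hFF (h.delays_neg a ha).1, (h.delays_neg a ha).2⟩
  delays_pos T t ht := ⟨hFF (h.delays_pos T t ht).1, (h.delays_pos T t ht).2⟩

theorem LabelSound.isGround_head (h : LabelSound P Gy F S n N c) (hP : RangeRestricted P Gy)
    (hg : N.goals = []) (hS : S.sym ∈ Gy) : N.head.IsGround := by
  rw [h.head]
  have hsym : c.head.sym ∈ Gy := by
    rw [← c.head.sym_subst N.subst, ← h.head, h.inst.sym_eq]
    exact hS
  refine Atom.isGround_subst_of fun x hx => ?_
  obtain ⟨a, ha, hGy, hxa⟩ := hP c h.clause_mem hsym x hx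
  rcases h.ground a ha hGy with h' | h'
  · simp [hg] at h'
  · obtain ⟨d, -, hd⟩ := Atom.exists_const_of_isGround_subst h' hxa
    exact ⟨d, hd⟩

theorem LabelSound.body_true (h : LabelSound P Gy F S n N c) (hg : N.goals = [])
    (hd : N.delays = []) {σ : ℕ → C} (hσ : ∀ x, σ x ∈ HU P) {γ : Subst C}
    (hγ : N.subst.comp γ = groundSubst σ) :
    ∀ L ∈ c.body, LitTrue (wellFoundedModel P) (L.subst (groundSubst σ)) := by
  intro L hL
  rcases h.body L hL with h' | h'
  · simp [hg] at h'
  rw [hd] at h'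
  have hHB := subst_mem_HB h.clause_mem (Clause.atom_mem_atoms hL) hσ
  cases L with
  | pos a =>
    rcases h' with h' | ⟨_, _, h', -⟩
    · refine h' _ hHB ?_
      rw [← hγ, Atom.subst_comp]
      exact inst_subst _ _
    · simp at h'
  | neg a =>
    obtain ⟨h1, h' | h'⟩ := h'
    · show a.subst (groundSubst σ) ∈ _
      rw [← hγ, Atom.subst_comp, h1.subst_eq]
      exact h'
    · simp at h'

variable [DecidableEq C] [DecidableEq Q] {R : ComputationRule C Q}

/-- What remains true forever of an edge `e` below the node `b` of the tree for `S`. -/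
def EdgeSound (P : Program C Q) (R : ComputationRule C Q) (F : Forest C Q) (S : Atom C Q)
    (b : Branch C Q) : Edge C Q → Prop
  | .clause k => b = [] ∧ k < P.length
  | .answer h _ => InLanguage P h ∧ ∃ N a, F.Selects P R S b N (.pos a)
  | .negSuccess => ∃ N a, F.Selects P R S b N (.neg a)
  | .delay => ∃ N a, F.Selects P R S b N (.neg a)
  | .simplify d => d.InLanguage P ∧ ∃ N, label P R S b = some N ∧ N.goals = [] ∧ d ∈ N.delays
  | .fail => (∃ N a, F.Selects P R S b N (.neg a) ∧ a.IsGround ∧ F.HasUnconditional P R a a) ∨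
      ∃ N, label P R S b = some N ∧ N.goals = [] ∧ ∃ d ∈ N.delays, F.Refutes P R d

/-- The invariant of the forests of an evaluation. -/
structure Forest.Sound (P : Program C Q) (R : ComputationRule C Q) (Gy : Set (Pred C Q × ℕ))
    (F : Forest C Q) : Prop where
  hasTree : ∀ {S b}, (S, b) ∈ F.nodes → F.HasTree S
  subgoal : ∀ {S}, F.HasTree S → InLanguage P S
  edge : ∀ {S e b}, (S, e :: b) ∈ F.nodes → (S, b) ∈ F.nodes ∧ EdgeSound P R F S b e
  label : ∀ {S b N}, (S, b) ∈ F.nodes → label P R S b = some N →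
    ∃ c, LabelSound P Gy F S b.length N c
  completed : F.CompletelyEvaluated P R F.completed

/-! ### Soundness of unconditional answers -/

namespace Forest.Sound

theorem mem_true (hF : F.Sound P R Gy) {h g : Atom C Q} (hu : F.HasUnconditional P R S h)
    (hg : g ∈ HB P) (hi : Inst g h) : g ∈ (wellFoundedModel P).1 := by
  obtain ⟨b, N, hA, hd, rfl⟩ := hu
  obtain ⟨c, hc⟩ := hF.label hA.1.1 hA.2.1
  obtain ⟨τ, hτ, rfl⟩ := exists_groundSubst hg (hi.trans (inst_norm_left _))
  obtain ⟨σ, hσ, hστ⟩ := exists_comp_groundSubst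
    (fun x k hx => constsOf_subset_HU P (hc.consts x k hx)) hτ
  rw [hc.head, ← Atom.subst_comp, hστ]
  exact mem_true_of_body hc.clause_mem hσ (hc.body_true hA.2.2 hd hσ hστ)

theorem inst_of_hasAnswer (hF : F.Sound P R Gy) {h : Atom C Q} (ha : F.HasAnswer P R S h) :
    Inst h S := by
  obtain ⟨b, N, hA, rfl⟩ := ha
  obtain ⟨c, hc⟩ := hF.label hA.1.1 hA.2.1
  exact (inst_norm_left _).trans hc.inst

theorem inLanguage_of_hasAnswer (hF : F.Sound P R Gy) {h : Atom C Q}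
    (ha : F.HasAnswer P R S h) : InLanguage P h := by
  obtain ⟨b, N, hA, rfl⟩ := ha
  obtain ⟨c, hc⟩ := hF.label hA.1.1 hA.2.1
  rw [hc.head]
  exact .norm_subst hc.clause_mem c.head_mem_atoms hc.consts

theorem isGround_of_hasAnswer (hF : F.Sound P R Gy) (hP : RangeRestricted P Gy) {h : Atom C Q}
    (ha : F.HasAnswer P R S h) (hS : S.sym ∈ Gy) : h.IsGround := by
  obtain ⟨b, N, hA, rfl⟩ := ha
  obtain ⟨c, hc⟩ := hF.label hA.1.1 hA.2.1
  exact Atom.isGround_norm.2 (hc.isGround_head hP hA.2.2 hS)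

theorem hasTree_of_hasAnswer (hF : F.Sound P R Gy) {h : Atom C Q}
    (ha : F.HasAnswer P R S h) : F.HasTree S := by
  obtain ⟨b, N, hA, -⟩ := ha
  exact hF.hasTree hA.1.1

/-! ### Following a ground clause instance through a completed tree -/

/-- Let the ground instance of the `k`-th clause by `σ` match a completed subgoal `S`. If each
positive body atom is covered by acceptable (`Ok`) answers and each negated atom is acceptable
(`Okn`), where acceptable answers are supported and acceptable negated atoms have no unconditional
answer, then the branch that returns these answers has not been failed: it ends in an answer node,
all of whose delayed literals are acceptable. -/
theorem exists_branch (hF : F.Sound P R Gy) (hS : S ∈ F.completed) {k : ℕ}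
    (hk : P[k]? = some c) {σ : Subst C} (hσ : Inst (c.head.subst σ) S)
    {Ok : Atom C Q → Atom C Q → Prop} {Okn : Atom C Q → Prop}
    (hpos : ∀ a, Literal.pos a ∈ c.body → ∀ T ∈ F.completed, Inst (a.subst σ) T →
      ∃ h, F.HasAnswer P R T h ∧ Ok T h ∧ Inst (a.subst σ) h)
    (hneg : ∀ a, Literal.neg a ∈ c.body → Okn (a.subst σ))
    (hOk : ∀ T h, Ok T h → F.Supported P R T h)
    (hOkn : ∀ a, Okn a → ¬ F.HasUnconditional P R a a) :
    ∃ b N γ, F.IsAnswer P R S b N ∧ N.clause = k ∧ N.subst.comp γ = σ ∧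
      (∀ T h, Delayed.pos T h ∈ N.delays → Ok T h) ∧ ∀ a, Delayed.neg a ∈ N.delays → Okn a := by
  obtain ⟨-, hcl, hsel⟩ := hF.completed S hS
  have main : ∀ n b N γ, (S, b) ∈ F.nodes → BKB.label P R S b = some N →
      2 * N.goals.length + N.delays.length < n → N.clause = k → N.subst.comp γ = σ →
      (∀ T h, Delayed.pos T h ∈ N.delays → Ok T h) → (∀ a, Delayed.neg a ∈ N.delays → Okn a) →
      ∃ b N γ, F.IsAnswer P R S b N ∧ N.clause = k ∧ N.subst.comp γ = σ ∧
        (∀ T h, Delayed.pos T h ∈ N.delays → Ok T h) ∧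
        ∀ a, Delayed.neg a ∈ N.delays → Okn a := by
    intro n
    induction n with
    | zero => exact fun _ _ _ _ _ h => absurd h (Nat.not_lt_zero _)
    | succ n ih =>
      intro b N γ hb hN hlt hNk hγ hdp hdn
      obtain ⟨c', hc'⟩ := hF.label hb hN
      obtain rfl : c = c' := by
        have := hc'.clause
        rw [hNk, hk, Option.some.injEq] at this
        exact this
      by_cases hg : N.goals = []
      · by_cases hleaf : F.IsLeaf S b
        · exact ⟨b, N, γ, ⟨hleaf, hN, hg⟩, hNk, hγ, hdp, hdn⟩
        · obtain ⟨e, he⟩ : ∃ e, (S, e :: b) ∈ F.nodes := by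
            by_contra hcon
            exact hleaf ⟨hb, fun e he => hcon ⟨e, he⟩⟩
          have hes := (hF.edge he).2
          cases e with
          | clause k' =>
            obtain ⟨rfl, -⟩ := hes
            simp [label_nil] at hN
          | answer h f =>
            obtain ⟨-, N', a, hs⟩ := hes
            exact (hs.ne_nil hN hg).elim
          | negSuccess =>
            obtain ⟨N', a, hs⟩ := hes
            exact (hs.ne_nil hN hg).elim
          | delay =>
            obtain ⟨N', a, hs⟩ := hes
            exact (hs.ne_nil hN hg).elim
          | simplify d =>
            obtain ⟨-, N', hN', -, hd⟩ := hes
            rw [hN, Option.some.injEq] at hN'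
            subst hN'
            refine ih _ _ γ he (label_simplify hN) ?_ hNk hγ
              (fun T t ht => hdp T t (List.mem_filter.1 ht).1)
              (fun a ha => hdn a (List.mem_filter.1 ha).1)
            have : (N.delays.filter (· ≠ d)).length < N.delays.length :=
              List.length_filter_lt_length_iff_exists.2 ⟨d, hd, by simp⟩
            simp only
            omega
          | fail =>
            rcases hes with ⟨N', a, hs, -⟩ | ⟨N', hN', -, d, hd, hr⟩
            · exact (hs.ne_nil hN hg).elim
            · rw [hN, Option.some.injEq] at hN'
              subst hN'
              cases d with
              | neg a => exact (hOkn a (hdn a hd) hr).elim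
              | pos T h => exact (hr (hOk T h (hdp T h hd))).elim
      · obtain ⟨L, rest, hp⟩ := R.exists_pick hg
        obtain ⟨hmem, hlen⟩ := ComputationRule.pick_spec hp
        obtain ⟨L₀, hL₀, rfl⟩ := hc'.goals L ((hmem L).2 (.inl rfl))
        obtain ⟨⟨hT, hTc⟩, hret⟩ := hsel b N _ ⟨hb, hN, rest, hp⟩
        cases L₀ with
        | pos a =>
          have hi : Inst (a.subst σ) (a.subst N.subst) := by
            rw [← hγ, Atom.subst_comp]
            exact inst_subst _ _
          obtain ⟨h, hh, hok, hih⟩ := hpos a hL₀ _ (hTc.elim id id) (hi.trans (inst_norm_right _))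
          rw [← hγ, Atom.subst_comp] at hih
          obtain ⟨μ, η, hμ, hμη⟩ := mguApart_complete hih
          have hlab := fun f => label_answer (h := h) (f := f) hN hp
          simp only [hμ, Option.map_some] at hlab
          obtain ⟨f, hf⟩ := hret h hh (by rw [hlab]; rfl)
          refine ih _ _ η hf (hlab f) ?_ hNk ?_ ?_ ?_
          · cases f <;> simp <;> omega
          · simp only [Subst.comp_assoc, hμη, hγ]
          · intro T t ht
            cases f with
            | false => exact hdp T t ht
            | true =>
              rcases List.mem_cons.1 ht with ht | ht
              · simp only [Delayed.pos.injEq] at ht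
                obtain ⟨rfl, rfl⟩ := ht
                exact hok
              · exact hdp T t ht
          · intro a' ha'
            cases f with
            | false => exact hdn a' ha'
            | true =>
              rcases List.mem_cons.1 ha' with ht | ht
              · cases ht
              · exact hdn a' ht
        | neg a =>
          have hpn : R.pick N.goals = some (.neg (a.subst N.subst), rest) := hp
          obtain ⟨e, he⟩ := hret
          have hes := (hF.edge he).2
          have hselN : F.Selects P R S b N (.neg (a.subst N.subst)) := ⟨hb, hN, rest, hp⟩
          have hσa : (a.subst N.subst).IsGround → Okn (a.subst N.subst) := by
            intro hgr
            have := hneg a hL₀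
            rwa [← hγ, Atom.subst_comp, hgr.subst_eq] at this
          cases e with
          | clause k' =>
            obtain ⟨rfl, -⟩ := hes
            simp [label_nil] at hN
          | answer h f =>
            obtain ⟨-, N', a', hs⟩ := hes
            cases (hs.unique hselN).2
          | negSuccess =>
            exact ih _ _ γ he (label_negSuccess hN hpn) (by simp; omega) hNk hγ hdp hdn
          | delay =>
            have hl := label_delay hN hpn
            obtain ⟨c', hc''⟩ := hF.label he hl
            refine ih _ _ γ he hl (by simp; omega) hNk hγ ?_ ?_
            · intro T t ht
              rcases List.mem_cons.1 ht with ht | ht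
              · cases ht
              · exact hdp T t ht
            · intro a' ha'
              rcases List.mem_cons.1 ha' with ht | ht
              · simp only [Delayed.neg.injEq] at ht
                rw [ht]
                exact hσa (hc''.delays_neg _ List.mem_cons_self).2
              · exact hdn a' ht
          | simplify d =>
            obtain ⟨-, N', hN', hg', -⟩ := hes
            exact (hselN.ne_nil hN' hg').elim
          | fail =>
            rcases hes with ⟨N', a', hs, hgr, hu⟩ | ⟨N', hN', hg', -⟩
            · have := (hs.unique hselN).2
              simp only [Literal.neg.injEq] at this
              subst this
              exact (hOkn _ (hσa hgr) hu).elim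
            · exact (hselN.ne_nil hN' hg').elim
  obtain ⟨μ, η, hμ, hμη⟩ := mguApart_complete hσ
  have hlab : BKB.label P R S [.clause k] =
      some ⟨k, μ, c.head.subst μ, c.body.map (Literal.subst μ), []⟩ := by
    simp [BKB.label, hk, hμ]
  exact main _ _ _ η (hcl k (by rw [hlab]; rfl)) hlab (Nat.lt_succ_self _) rfl hμη (by simp)
    (by simp)

end Forest.Sound

end SLG

section SLG

variable {C : Type u} {Q : Type v} [DecidableEq C] [DecidableEq Q] [Inhabited C]
variable {P : Program C Q} {R : ComputationRule C Q} {F F' : Forest C Q}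
variable {Gy : Set (Pred C Q × ℕ)} {S : Atom C Q} {n : ℕ} {N : Label C Q} {c : Clause C Q}

/-! ### Completed tables contain all atoms that are not false -/

namespace Forest.Sound

/-- The ground instances of completed subgoals not covered by supported answers form an unfounded
set. -/
theorem mem_false (hF : F.Sound P R Gy) {g : Atom C Q} (hS : S ∈ F.completed) (hg : g ∈ HB P)
    (hi : Inst g S) (hn : ∀ h, F.HasAnswer P R S h → Inst g h → ¬ F.Supported P R S h) :
    g ∈ (wellFoundedModel P).2 := by
  refine subset_false_of_isUnfounded (U := {g | g ∈ HB P ∧ ∃ S ∈ F.completed, Inst g S ∧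
    ∀ h, F.HasAnswer P R S h → Inst g h → ¬ F.Supported P R S h}) ⟨fun _ h => h.1, ?_⟩
    ⟨hg, S, hS, hi, hn⟩
  clear hn hi hg hS
  rintro _ ⟨-, S, hS, hi, hn⟩ _ ⟨c, hc, σ, hσ, rfl⟩ rfl
  by_contra hcon
  push Not at hcon
  obtain ⟨k, hk⟩ := List.mem_iff_getElem?.1 hc
  obtain ⟨b, N, γ, hA, hNk, hγ, hdp, -⟩ := hF.exists_branch hS hk hi
    (Ok := F.Supported P R) (Okn := fun a => ¬ F.HasUnconditional P R a a)
    (fun a ha T hT hiT => by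
      have hHB := subst_mem_HB hc (Clause.atom_mem_atoms ha) hσ
      by_contra hcon'
      push Not at hcon'
      exact (hcon _ (List.mem_map_of_mem ha)).2 _
        ⟨hHB, T, hT, hiT, fun h hh hih hs => hcon' h hh hs hih⟩ rfl)
    (fun a ha hu => (hcon _ (List.mem_map_of_mem ha)).1
      (hF.mem_true hu (subst_mem_HB hc (Clause.atom_mem_atoms ha) hσ) (Inst.refl _)))
    (fun _ _ h => h) (fun _ h => h)
  obtain ⟨c', hc'⟩ := hF.label hA.1.1 hA.2.1
  obtain rfl : c = c' := by
    have := hc'.clause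
    rw [hNk, hk, Option.some.injEq] at this
    exact this
  refine hn _ ⟨b, N, hA, rfl⟩ ?_ (.answer S b N hA hdp)
  refine Inst.trans ?_ (inst_norm_right _)
  rw [hc'.head]
  change Inst (c.head.subst _) _
  rw [← hγ, Atom.subst_comp]
  exact inst_subst _ _

theorem mem_false_of_succeeds (hF : F.Sound P R Gy) {a : Atom C Q}
    (hs : F.Succeeds P R (.neg a)) (ha : a ∈ HB P) : a ∈ (wellFoundedModel P).2 :=
  hF.mem_false hs.1 ha (Inst.refl a) fun h hh => absurd ⟨h, hh⟩ hs.2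

/-! ### The invariant is preserved -/

theorem inLanguage_of_selects (hF : F.Sound P R Gy) {b : Branch C Q} {L : Literal C Q}
    (hs : F.Selects P R S b N L) : InLanguage P L.atom.norm := by
  obtain ⟨hb, hN, rest, hp⟩ := hs
  obtain ⟨c, hc⟩ := hF.label hb hN
  obtain ⟨L₀, hL₀, rfl⟩ := hc.goals L (((ComputationRule.pick_spec hp).1 L).2 (.inl rfl))
  rw [Literal.atom_subst]
  exact .norm_subst hc.clause_mem (Clause.atom_mem_atoms hL₀) hc.consts

/-- The label of a new node is sound. -/
theorem labelSound_of_canExtend (hF : F.Sound P R Gy) (hP : RangeRestricted P Gy)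
    {b : Branch C Q} {e : Edge C Q} (hb : (S, b) ∈ F.nodes) (he : F.CanExtend P R S b e)
    {N' : Label C Q} (hN' : BKB.label P R S (e :: b) = some N') :
    ∃ c, LabelSound P Gy F S (e :: b).length N' c := by
  cases e with
  | clause k =>
    obtain ⟨c, θ, hk, hθ, rfl, rfl⟩ := label_clause hN'
    have hc : c ∈ P := List.mem_of_getElem? hk
    exact ⟨c, {
      clause := hk
      head := rfl
      inst := mguApart_sound hθ
      consts := mguApart_constsIn hθ (fun d hd => ⟨c, hc, _, c.head_mem_atoms, hd⟩)
        (hF.subgoal hb).consts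
      goals := fun L hL => by
        obtain ⟨L₀, hL₀, rfl⟩ := List.mem_map.1 hL
        exact ⟨L₀, hL₀, rfl⟩
      body := fun L hL => .inl (List.mem_map_of_mem hL)
      ground := fun a ha _ => .inl (List.mem_map_of_mem (f := Literal.subst θ) ha)
      delays_neg := by simp
      delays_pos := by simp
      depth := by simp }⟩
  | answer h f =>
    obtain ⟨⟨N, a, hs, hh, hf⟩, -, -⟩ := he
    obtain ⟨-, hN, rest, hp⟩ := hs
    obtain ⟨c, hc⟩ := hF.label hb hN
    obtain ⟨hmem, hlen⟩ := ComputationRule.pick_spec hp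
    rw [label_answer hN hp, Option.map_eq_some_iff] at hN'
    obtain ⟨μ, hμ, rfl⟩ := hN'
    have hia : Inst (a.subst μ) h := mguApart_sound hμ
    have hhL := hF.inLanguage_of_hasAnswer hh
    have hsub : N.delays ⊆ (if f then .pos a.norm h :: N.delays else N.delays) := by
      cases f
      · exact List.Subset.refl _
      · exact List.subset_cons_self _ _
    obtain ⟨L₀, hL₀, haL₀⟩ := hc.goals _ ((hmem _).2 (.inl rfl))
    have haL : ∀ d ∈ a.consts, d ∈ constsOf P := by
      cases L₀ with
      | pos a₀ =>
        simp only [Literal.subst, Literal.pos.injEq] at haL₀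
        intro d hd
        rw [haL₀] at hd
        rcases Atom.mem_consts_subst hd with hd | ⟨x, -, hx⟩
        · exact ⟨c, hc.clause_mem, a₀, Clause.atom_mem_atoms hL₀, hd⟩
        · exact hc.consts x d hx
      | neg a₀ => cases haL₀
    exact ⟨c, {
      clause := hc.clause
      head := by
        simp only [hc.head, Atom.subst_comp]
      inst := (inst_subst _ _).trans hc.inst
      consts := hc.consts.comp (mguApart_constsIn hμ haL hhL.consts)
      goals := fun L hL => by
        obtain ⟨L₁, hL₁, rfl⟩ := List.mem_map.1 hL
        obtain ⟨L₀, hL₀, rfl⟩ := hc.goals L₁ ((hmem _).2 (.inr hL₁))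
        exact ⟨L₀, hL₀, (Literal.subst_comp _ _ _).symm⟩
      body := fun L hL => by
        simp only [Literal.subst_comp]
        rcases hc.body L hL with hL' | hL'
        · rcases (hmem _).1 hL' with hL' | hL'
          · right
            rw [hL']
            cases f with
            | false =>
              exact .inl fun g hg hgi => hF.mem_true (hf rfl) hg (hgi.trans hia)
            | true => exact .inr ⟨a.norm, h, List.mem_cons_self, hia⟩
          · exact .inl (List.mem_map_of_mem hL')
        · exact .inr (hL'.subst hsub μ)
      ground := fun a' ha' hGy => by
        simp only [Atom.subst_comp]
        rcases hc.ground a' ha' hGy with hL' | hL'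
        · rcases (hmem _).1 hL' with hL' | hL'
          · right
            simp only [Literal.pos.injEq] at hL'
            rw [hL']
            refine hia.isGround (hF.isGround_of_hasAnswer hP hh ?_)
            rw [(inst_norm_left a).sym_eq, ← hL', Atom.sym_subst]
            exact hGy
          · exact .inl (List.mem_map_of_mem (f := Literal.subst μ) hL')
        · exact .inr ((inst_subst _ _).isGround hL')
      delays_neg := fun a' ha' => by
        cases f with
        | false => exact hc.delays_neg a' ha'
        | true =>
          rcases List.mem_cons.1 ha' with h' | h'
          · cases h'
          · exact hc.delays_neg a' h'
      delays_pos := fun T t ht => by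
        cases f with
        | false => exact hc.delays_pos T t ht
        | true =>
          rcases List.mem_cons.1 ht with h' | h'
          · simp only [Delayed.pos.injEq] at h'
            obtain ⟨rfl, rfl⟩ := h'
            exact ⟨hF.hasTree_of_hasAnswer hh, hhL⟩
          · exact hc.delays_pos T t h'
      depth := by
        have := hc.depth
        cases f <;> simp <;> omega }⟩
  | negSuccess =>
    obtain ⟨-, N, a, hs, hgr, hsuc⟩ := he
    have hs' := hs
    obtain ⟨-, hN, rest, hp⟩ := hs
    obtain ⟨c, hc⟩ := hF.label hb hN
    obtain ⟨hmem, hlen⟩ := ComputationRule.pick_spec hp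
    rw [label_negSuccess hN hp, Option.some.injEq] at hN'
    subst hN'
    have hL := hF.inLanguage_of_selects hs'
    rw [Literal.atom, hgr.norm_eq] at hL
    exact ⟨c, { hc with
      goals := fun L hL => hc.goals L ((hmem L).2 (.inr hL))
      body := fun L hLb => by
        rcases hc.body L hLb with hL' | hL'
        · rcases (hmem _).1 hL' with hL' | hL'
          · rw [hL']
            exact .inr ⟨hgr, .inl (hF.mem_false_of_succeeds hsuc (hL.mem_HB hgr))⟩
          · exact .inl hL'
        · exact .inr hL'
      ground := fun a' ha' hGy => by
        refine (hc.ground a' ha' hGy).imp (fun h => ?_) id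
        exact ((hmem _).1 h).resolve_left (by simp)
      depth := by
        have := hc.depth
        simp
        omega }⟩
  | delay =>
    obtain ⟨-, N, a, hs, hgr, hT⟩ := he
    obtain ⟨-, hN, rest, hp⟩ := hs
    obtain ⟨c, hc⟩ := hF.label hb hN
    obtain ⟨hmem, hlen⟩ := ComputationRule.pick_spec hp
    rw [label_delay hN hp, Option.some.injEq] at hN'
    subst hN'
    exact ⟨c, { hc with
      goals := fun L hL => hc.goals L ((hmem L).2 (.inr hL))
      body := fun L hLb => by
        rcases hc.body L hLb with hL' | hL'
        · rcases (hmem _).1 hL' with hL' | hL'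
          · rw [hL']
            exact .inr ⟨hgr, .inr List.mem_cons_self⟩
          · exact .inl hL'
        · refine .inr ?_
          have := hL'.subst (List.subset_cons_self (.neg a) N.delays) Term.var
          rwa [← Literal.subst_comp, show N.subst.comp Term.var = N.subst from
            funext fun x => Term.subst_var _] at this
      ground := fun a' ha' hGy => by
        refine (hc.ground a' ha' hGy).imp (fun h => ?_) id
        exact ((hmem _).1 h).resolve_left (by simp)
      delays_neg := fun a' ha' => by
        rcases List.mem_cons.1 ha' with h' | h'
        · simp only [Delayed.neg.injEq] at h'
          exact h' ▸ ⟨hT, hgr⟩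
        · exact hc.delays_neg a' h'
      delays_pos := fun T t ht => by
        rcases List.mem_cons.1 ht with h' | h'
        · cases h'
        · exact hc.delays_pos T t h'
      depth := by
        have := hc.depth
        simp
        omega }⟩
  | simplify d =>
    obtain ⟨N, hA, hd, hsuc⟩ := he
    obtain ⟨c, hc⟩ := hF.label hb hA.2.1
    rw [label_simplify hA.2.1, Option.some.injEq] at hN'
    subst hN'
    exact ⟨c, { hc with
      body := fun L hLb => by
        refine (hc.body L hLb).imp id fun hL => ?_
        generalize L.subst N.subst = L' at hL
        cases L' with
        | pos a =>
          rcases hL with hL | ⟨T, t, ht, hi⟩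
          · exact .inl hL
          · by_cases hd' : Delayed.pos T t = d
            · subst hd'
              exact .inl fun g hg hgi => hF.mem_true hsuc hg (hgi.trans hi)
            · exact .inr ⟨T, t, List.mem_filter.2 ⟨ht, by simpa using hd'⟩, hi⟩
        | neg a =>
          obtain ⟨hgr, hL | hL⟩ := hL
          · exact ⟨hgr, .inl hL⟩
          · by_cases hd' : Delayed.neg a = d
            · subst hd'
              exact ⟨hgr, .inl (hF.mem_false_of_succeeds hsuc
                ((hF.subgoal (hc.delays_neg a hL).1).mem_HB hgr))⟩
            · exact ⟨hgr, .inr (List.mem_filter.2 ⟨hL, by simpa using hd'⟩)⟩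
      delays_neg := fun a ha => hc.delays_neg a (List.mem_filter.1 ha).1
      delays_pos := fun T t ht => hc.delays_pos T t (List.mem_filter.1 ht).1
      depth := by
        have := hc.depth
        have : (N.delays.filter (· ≠ d)).length < N.delays.length :=
          List.length_filter_lt_length_iff_exists.2 ⟨d, hd, by simp⟩
        simp only [List.length_cons]
        omega }⟩
  | fail => simp [label_fail] at hN'

theorem edgeSound_of_canExtend (hF : F.Sound P R Gy) {b : Branch C Q} {e : Edge C Q}
    (he : F.CanExtend P R S b e) : EdgeSound P R F S b e := by
  cases e with
  | clause k =>
    obtain ⟨rfl, hk⟩ := he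
    obtain ⟨N, hN⟩ := Option.isSome_iff_exists.1 hk
    obtain ⟨c, θ, hc, -⟩ := label_clause hN
    exact ⟨rfl, (List.getElem?_eq_some_iff.1 hc).1⟩
  | answer h f =>
    obtain ⟨⟨N, a, hs, hh, -⟩, -⟩ := he
    exact ⟨hF.inLanguage_of_hasAnswer hh, N, a, hs⟩
  | negSuccess =>
    obtain ⟨-, N, a, hs, -⟩ := he
    exact ⟨N, a, hs⟩
  | delay =>
    obtain ⟨-, N, a, hs, -⟩ := he
    exact ⟨N, a, hs⟩
  | simplify d =>
    obtain ⟨N, hA, hd, -⟩ := he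
    refine ⟨?_, N, hA.2.1, hA.2.2, hd⟩
    obtain ⟨c, hc⟩ := hF.label hA.1.1 hA.2.1
    cases d with
    | neg a => exact hF.subgoal (hc.delays_neg a hd).1
    | pos T t => exact ⟨hF.subgoal (hc.delays_pos T t hd).1, (hc.delays_pos T t hd).2⟩
  | fail =>
    rcases he with ⟨-, N, a, hs⟩ | ⟨N, hA, hd⟩
    · exact .inl ⟨N, a, hs⟩
    · exact .inr ⟨N, hA.2.1, hA.2.2, hd⟩

end Forest.Sound

theorem EdgeSound.step (hF : F.Sound P R Gy) (h : SLGStep P R F F') {b : Branch C Q}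
    {e : Edge C Q} (he : EdgeSound P R F S b e) : EdgeSound P R F' S b e := by
  have hs : ∀ {N L}, F.Selects P R S b N L → F'.Selects P R S b N L :=
    fun hs => ⟨h.nodes_subset hs.1, hs.2⟩
  cases e with
  | clause k => exact he
  | answer t f =>
    obtain ⟨h1, N, a, h2⟩ := he
    exact ⟨h1, N, a, hs h2⟩
  | negSuccess =>
    obtain ⟨N, a, h2⟩ := he
    exact ⟨N, a, hs h2⟩
  | delay =>
    obtain ⟨N, a, h2⟩ := he
    exact ⟨N, a, hs h2⟩
  | simplify d => exact he
  | fail =>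
    rcases he with ⟨N, a, h1, h2, h3⟩ | ⟨N, h1, h2, d, hd, h3⟩
    · exact .inl ⟨N, a, hs h1, h2, h.hasUnconditional h3⟩
    · exact .inr ⟨N, h1, h2, d, hd, h.refutes hF.completed h3⟩

theorem Forest.sound_init (hS : InLanguage P S) : (Forest.init S).Sound P R Gy where
  hasTree h := by
    simp only [Forest.init, Set.mem_singleton_iff, Prod.mk.injEq] at h
    rw [h.1]
    exact Set.mem_singleton _
  subgoal h := by
    simp only [Forest.HasTree, Forest.init, Set.mem_singleton_iff, Prod.mk.injEq] at h
    exact h.1 ▸ hS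
  edge h := by simp [Forest.init] at h
  label h hN := by
    simp only [Forest.init, Set.mem_singleton_iff, Prod.mk.injEq] at h
    rw [h.2, label_nil] at hN
    cases hN
  completed T hT := absurd hT (Set.notMem_empty T)

theorem Forest.Sound.step (hF : F.Sound P R Gy) (hP : RangeRestricted P Gy)
    (h : SLGStep P R F F') : F'.Sound P R Gy := by
  have hce := h.completelyEvaluated hF.completed
  have hsub := h.nodes_subset
  have hedge : ∀ {S e b}, (S, e :: b) ∈ F.nodes → (S, b) ∈ F'.nodes ∧ EdgeSound P R F' S b e :=
    fun hm => ⟨hsub (hF.edge hm).1, EdgeSound.step hF h (hF.edge hm).2⟩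
  have hlabel : ∀ {S b N}, (S, b) ∈ F.nodes → BKB.label P R S b = some N →
      ∃ c, LabelSound P Gy F' S b.length N c := fun hm hN => by
    obtain ⟨c, hc⟩ := hF.label hm hN
    exact ⟨c, hc.mono hsub⟩
  rcases h.cases_nodes with ⟨S', b', N', L, h1, h2, rfl⟩ | ⟨S', b', e', h1, h2, h3, rfl⟩ |
    ⟨G, -, -, -, rfl⟩
  · refine ⟨?_, ?_, ?_, ?_, hce⟩
    · rintro S b (hm | hm)
      · simp only [Prod.mk.injEq] at hm
        rw [hm.1]
        exact .inl rfl
      · exact hsub (hF.hasTree hm)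
    · rintro S (hm | hm)
      · simp only [Prod.mk.injEq] at hm
        rw [hm.1]
        exact hF.inLanguage_of_selects h1
      · exact hF.subgoal hm
    · rintro S e b (hm | hm)
      · simp at hm
      · exact hedge hm
    · rintro S b N (hm | hm) hN
      · simp only [Prod.mk.injEq] at hm
        rw [hm.2, label_nil] at hN
        cases hN
      · exact hlabel hm hN
  · refine ⟨?_, ?_, ?_, ?_, hce⟩
    · rintro S b (hm | hm)
      · simp only [Prod.mk.injEq] at hm
        rw [hm.1]
        exact hsub (hF.hasTree h1)
      · exact hsub (hF.hasTree hm)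
    · rintro S (hm | hm)
      · simp at hm
      · exact hF.subgoal hm
    · rintro S e b (hm | hm)
      · simp only [Prod.mk.injEq, List.cons.injEq] at hm
        obtain ⟨rfl, rfl, rfl⟩ := hm
        exact ⟨hsub h1, EdgeSound.step hF h (hF.edgeSound_of_canExtend h3)⟩
      · exact hedge hm
    · rintro S b N (hm | hm) hN
      · simp only [Prod.mk.injEq] at hm
        obtain ⟨rfl, rfl⟩ := hm
        obtain ⟨c, hc⟩ := hF.labelSound_of_canExtend hP h1 h3 hN
        exact ⟨c, hc.mono hsub⟩
      · exact hlabel hm hN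
  · exact ⟨hF.hasTree, hF.subgoal, hedge, hlabel, hce⟩

end SLG

/-! ### Evaluations to which no operation applies -/

section SLG

variable {C : Type u} {Q : Type v} [DecidableEq C] [DecidableEq Q] [Inhabited C]
variable {P : Program C Q} {R : ComputationRule C Q} {F : Forest C Q}
variable {Gy : Set (Pred C Q × ℕ)} {S : Atom C Q}

/-- The interpretation read off from the tables of a forest: an atom is true if every table for it
has an unconditional answer covering it, and false if no table for it has an answer covering it. -/
def tableInterp (P : Program C Q) (R : ComputationRule C Q) (F : Forest C Q) :
    PartialInterp C Q :=
  ({g | ∀ S, F.HasTree S → Inst g S → ∃ h, F.HasUnconditional P R S h ∧ Inst g h},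
   {g | ∀ S, F.HasTree S → Inst g S → ∀ h, F.HasAnswer P R S h → ¬ Inst g h})

namespace Forest.Sound

/-- A ground clause instance whose body is true in the tables yields a success branch. -/
theorem exists_success (hF : F.Sound P R Gy) (hterm : ∀ F', ¬ SLGStep P R F F')
    (hfl : ¬ F.Flounders P R) (hS : F.HasTree S) {k : ℕ} {c : Clause C Q} (hk : P[k]? = some c)
    {σ : Subst C} (hσ : Inst (c.head.subst σ) S)
    (hb : ∀ L ∈ c.body, LitTrue (tableInterp P R F) (L.subst σ)) :
    ∃ b N γ, F.IsAnswer P R S b N ∧ N.delays = [] ∧ N.clause = k ∧ N.subst.comp γ = σ := by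
  have hcompl : ∀ {T}, F.HasTree T → T ∈ F.completed := mem_completed_of_hasTree hterm hfl
  obtain ⟨b, N, γ, hA, hNk, hγ, hdp, hdn⟩ := hF.exists_branch (hcompl hS) hk hσ
    (Ok := F.HasUnconditional P R) (Okn := fun a => a ∈ (tableInterp P R F).2)
    (fun a ha T hT hi => by
      obtain ⟨h, hu, hih⟩ := hb _ ha T (hF.completed T hT).1 hi
      exact ⟨h, hu.hasAnswer, hu, hih⟩)
    (fun a ha => hb _ ha) (fun _ _ h => h.supported)
    (fun a ha hu => ha a (hF.hasTree_of_hasAnswer hu.hasAnswer) (Inst.refl a) a hu.hasAnswer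
      (Inst.refl a))
  refine ⟨b, N, γ, hA, ?_, hNk, hγ⟩
  -- all delayed literals succeed, so a remaining one could be simplified
  refine List.eq_nil_iff_forall_not_mem.2 fun d hd => hterm _ (.simplifySuccess F S b N d hA hd ?_)
  obtain ⟨c', hc'⟩ := hF.label hA.1.1 hA.2.1
  cases d with
  | neg a =>
    obtain ⟨hT, hgr⟩ := hc'.delays_neg a hd
    refine ⟨hcompl hT, ?_⟩
    rintro ⟨h, hh⟩
    have := (hF.inst_of_hasAnswer hh).eq_of_isGround hgr
    exact hdn a hd a hT (Inst.refl a) h hh (this ▸ Inst.refl a)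
  | pos T h => exact hdp T h hd

/-- No supported answer covers an atom of an unfounded set with respect to the intersection of the
well-founded model with the interpretation of the tables: resolved body literals are true in the
well-founded model, and delayed positive ones are covered by induction on the support. -/
theorem not_inst_of_supported (hF : F.Sound P R Gy) (hterm : ∀ F', ¬ SLGStep P R F F')
    (hfl : ¬ F.Flounders P R) {U : Set (Atom C Q)}
    (hU : IsUnfounded P (wellFoundedModel P ⊓ tableInterp P R F) U) {h : Atom C Q}
    (hs : F.Supported P R S h) (hS : F.HasTree S) {g : Atom C Q} (hg : g ∈ U) : ¬ Inst g h := by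
  have hUM : U ⊆ (wellFoundedModel P).2 :=
    subset_false_of_isUnfounded (hU.mono inf_le_left)
  induction hs generalizing g with
  | incomplete S h hn => exact absurd (mem_completed_of_hasTree hterm hfl hS) hn
  | answer S b N hA hd ih =>
    intro hi
    obtain ⟨c, hc⟩ := hF.label hA.1.1 hA.2.1
    obtain ⟨τ, hτ, rfl⟩ := exists_groundSubst (hU.1 hg) (hi.trans (inst_norm_left _))
    obtain ⟨σ, hσ, hστ⟩ := exists_comp_groundSubst
      (fun x k hx => constsOf_subset_HU P (hc.consts x k hx)) hτ
    rw [hc.head, ← Atom.subst_comp, hστ] at hg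
    obtain ⟨L, hL, hLf⟩ := hU.2 _ hg _ ⟨c, hc.clause_mem, σ, hσ, rfl⟩ rfl
    simp only [Clause.subst, List.mem_map] at hL
    obtain ⟨L, hL, rfl⟩ := hL
    have hHB := subst_mem_HB hc.clause_mem (Clause.atom_mem_atoms hL) hσ
    rcases hc.body L hL with hj | hj
    · simp [hA.2.2] at hj
    cases L with
    | pos a =>
      have hia : Inst (a.subst (groundSubst σ)) (a.subst N.subst) := by
        rw [← hστ, Atom.subst_comp]
        exact inst_subst _ _
      rcases hj with hj | ⟨T, t, ht, hit⟩
      · have htrue := hj _ hHB hia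
        rcases hLf with hLf | ⟨b', hb', he⟩
        · exact wellFoundedModel_consistent P htrue hLf.1
        · simp only [Literal.subst, Literal.pos.injEq] at he
          exact wellFoundedModel_consistent P htrue (hUM (he ▸ hb'))
      · have hT := (hc.delays_pos T t ht).1
        have hit' := hia.trans hit
        rcases hLf with hLf | ⟨b', hb', he⟩
        · rcases supported_iff.1 (hd T t ht) with hn | ⟨b', N', hA', rfl, -⟩
          · exact hn (mem_completed_of_hasTree hterm hfl hT)
          · have hT' : F.HasAnswer P R T N'.head.norm := ⟨b', N', hA', rfl⟩
            exact hLf.2 T hT (hit'.trans (hF.inst_of_hasAnswer hT')) _ hT' hit'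
        · simp only [Literal.subst, Literal.pos.injEq] at he
          exact ih T t ht hT hb' (he ▸ hit')
    | neg a =>
      rcases hLf with hLf | ⟨b', -, he⟩
      · have hgr : (a.subst N.subst).IsGround := hj.1
        have hLf' : a.subst (groundSubst σ) ∈ (wellFoundedModel P ⊓ tableInterp P R F).1 := hLf
        rw [← hστ, Atom.subst_comp, hgr.subst_eq] at hLf'
        rcases hj.2 with hj' | hj'
        · exact wellFoundedModel_consistent P hLf'.1 hj'
        · -- an atom true in the tables would have failed its delayed negation
          obtain ⟨h, hu, -⟩ := hLf'.2 _ (hc.delays_neg _ hj').1 (Inst.refl _)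
          have he := (hF.inst_of_hasAnswer hu.hasAnswer).eq_of_isGround hgr
          subst he
          exact hterm _ (.simplifyFailure F S b N _ hA hj' hu)
      · cases he

/-- At the end of an evaluation, the tables are complete for the well-founded model. -/
theorem wellFoundedModel_le_tableInterp (hF : F.Sound P R Gy)
    (hterm : ∀ F', ¬ SLGStep P R F F') (hfl : ¬ F.Flounders P R) :
    wellFoundedModel P ≤ tableInterp P R F := by
  have hfix : wfOperator P (wellFoundedModel P) = wellFoundedModel P := (wfOperator P).map_lfp
  have key : wfOperator P (wellFoundedModel P ⊓ tableInterp P R F) ≤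
      wellFoundedModel P ⊓ tableInterp P R F := by
    refine le_inf (((wfOperator P).monotone inf_le_left).trans hfix.le) ⟨?_, ?_⟩
    · rintro _ ⟨_, ⟨c, hc, σ, hσ, rfl⟩, rfl, hb⟩ T hT hi
      obtain ⟨k, hk⟩ := List.mem_iff_getElem?.1 hc
      obtain ⟨b, N, γ, hA, hd, hNk, hγ⟩ := hF.exists_success hterm hfl hT hk hi fun L hL =>
        (hb _ (List.mem_map_of_mem hL)).mono inf_le_right
      refine ⟨_, ⟨b, N, hA, hd, rfl⟩, Inst.trans ?_ (inst_norm_right _)⟩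
      obtain ⟨c', hc'⟩ := hF.label hA.1.1 hA.2.1
      obtain rfl : c = c' := by
        have := hc'.clause
        rw [hNk, hk, Option.some.injEq] at this
        exact this
      rw [hc'.head]
      change Inst (c.head.subst _) _
      rw [← hγ, Atom.subst_comp]
      exact inst_subst _ _
    · rintro g ⟨U, hU, hg⟩ T hT - h hh
      refine hF.not_inst_of_supported hterm hfl hU ?_ hT hg
      obtain ⟨b, N, hA, rfl⟩ := hh
      by_contra hcon
      exact hterm _ (.answerCompletion F T b N hA hcon)
  exact ((wfOperator P).lfp_le key).trans inf_le_right

end Forest.Sound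

end SLG

/-! ### Finiteness of the space of forests -/

section Finiteness

variable {C : Type u} {Q : Type v} {P : Program C Q}

theorem finite_lists {α : Type*} {s : Set α} (hs : s.Finite) (n : ℕ) :
    {l : List α | l.length ≤ n ∧ ∀ x ∈ l, x ∈ s}.Finite := by
  induction n with
  | zero =>
    refine (Set.finite_singleton []).subset ?_
    rintro l ⟨hl, -⟩
    simpa using hl
  | succ n ih =>
    refine ((Set.finite_singleton []).union ((hs.prod ih).image fun p => p.1 :: p.2)).subset ?_
    rintro l ⟨hl, hm⟩
    cases l with
    | nil => exact .inl rfl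
    | cons x l =>
      refine .inr ⟨(x, l), ⟨hm x List.mem_cons_self, ?_, fun y hy => ?_⟩, rfl⟩
      · simpa using hl
      · exact hm y (List.mem_cons_of_mem _ hy)

theorem finite_constsOf (P : Program C Q) : (constsOf P).Finite := by
  refine (P.flatMap fun cl => cl.atoms.flatMap Atom.consts).finite_toSet.subset ?_
  rintro c ⟨cl, hcl, a, ha, hc⟩
  simp only [List.mem_flatMap, Set.mem_ofPred_eq]
  exact ⟨cl, hcl, a, ha, hc⟩

theorem finite_inLanguage (P : Program C Q) : {a : Atom C Q | InLanguage P a}.Finite := by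
  have hsyms : {s : Pred C Q × ℕ | ∃ cl ∈ P, ∃ b ∈ cl.atoms, b.sym = s}.Finite := by
    refine (P.flatMap fun cl => cl.atoms.map Atom.sym).finite_toSet.subset ?_
    rintro s ⟨cl, hcl, b, hb, h⟩
    simp only [List.mem_flatMap, List.mem_map, Set.mem_ofPred_eq]
    exact ⟨cl, hcl, b, hb, h⟩
  refine Set.Finite.subset (hsyms.biUnion (t := fun s => (fun l => (⟨s.1, l⟩ : Atom C Q)) ''
    {l | l.length ≤ s.2 ∧ ∀ t ∈ l, t ∈ Term.var '' Set.Iio s.2 ∪ Term.const '' constsOf P})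
    fun s _ => (finite_lists (((Set.finite_Iio _).image _).union
      ((finite_constsOf P).image _)) _).image _) ?_
  intro a ha
  refine Set.mem_biUnion (x := a.sym) ha.sym ⟨a.args, ⟨le_rfl, fun t ht => ?_⟩, rfl⟩
  cases t with
  | var x => exact .inl ⟨x, ha.vars x (Atom.mem_vars.2 ht), rfl⟩
  | const c => exact .inr ⟨c, ha.consts c (Atom.mem_consts.2 ht), rfl⟩

/-- The edges that occur in the trees for the program `P`. -/
def possibleEdges (P : Program C Q) : Set (Edge C Q) :=
  Edge.clause '' Set.Iio P.length ∪
    (fun p : Atom C Q × Bool => Edge.answer p.1 p.2) '' ({a | InLanguage P a} ×ˢ Set.univ) ∪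
    {.negSuccess, .delay, .fail} ∪
    (fun a : Atom C Q => Edge.simplify (.neg a)) '' {a | InLanguage P a} ∪
    (fun p : Atom C Q × Atom C Q => Edge.simplify (.pos p.1 p.2)) ''
      ({a | InLanguage P a} ×ˢ {a | InLanguage P a})

theorem finite_possibleEdges (P : Program C Q) : (possibleEdges P).Finite := by
  have h := finite_inLanguage P
  exact (((((Set.finite_Iio _).image _).union ((h.prod Set.finite_univ).image _)).union
    (by simp)).union (h.image _)).union ((h.prod h).image _)

/-- A bound for the length of the branches: the invariant bounds the depth of labelled nodes by
`1 + 2 * c.body.length`, and one failure node may follow. -/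
def maxDepth (P : Program C Q) : ℕ := 2 + 2 * (P.map fun c => c.body.length).sum

/-- The nodes that occur in the forests of evaluations of the program `P`. -/
def possibleNodes (P : Program C Q) : Set (Atom C Q × Branch C Q) :=
  {a | InLanguage P a} ×ˢ {b | b.length ≤ maxDepth P ∧ ∀ e ∈ b, e ∈ possibleEdges P}

theorem finite_possibleNodes (P : Program C Q) : (possibleNodes P).Finite :=
  (finite_inLanguage P).prod (finite_lists (finite_possibleEdges P) _)

variable [DecidableEq C] [DecidableEq Q] {R : ComputationRule C Q} {F : Forest C Q}
variable {S : Atom C Q}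

theorem EdgeSound.mem_possibleEdges {b : Branch C Q} {e : Edge C Q}
    (h : EdgeSound P R F S b e) : e ∈ possibleEdges P := by
  unfold possibleEdges
  cases e with
  | clause k => exact .inl (.inl (.inl (.inl ⟨k, h.2, rfl⟩)))
  | answer a f => exact .inl (.inl (.inl (.inr ⟨(a, f), ⟨h.1, Set.mem_univ _⟩, rfl⟩)))
  | negSuccess => exact .inl (.inl (.inr (.inl rfl)))
  | delay => exact .inl (.inl (.inr (.inr (.inl rfl))))
  | fail => exact .inl (.inl (.inr (.inr (.inr rfl))))
  | simplify d =>
    cases d with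
    | neg a => exact .inl (.inr ⟨a, h.1, rfl⟩)
    | pos T t => exact .inr ⟨(T, t), h.1, rfl⟩

variable [Inhabited C] {Gy : Set (Pred C Q × ℕ)}

namespace Forest.Sound

theorem length_le (hF : F.Sound P R Gy) {b : Branch C Q} {N : Label C Q}
    (hb : (S, b) ∈ F.nodes) (hN : BKB.label P R S b = some N) : b.length < maxDepth P := by
  obtain ⟨c, hc⟩ := hF.label hb hN
  have := hc.depth
  have : c.body.length ≤ (P.map fun c => c.body.length).sum :=
    List.single_le_sum (by simp) _ (List.mem_map_of_mem hc.clause_mem)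
  unfold maxDepth
  omega

theorem nodes_subset (hF : F.Sound P R Gy) : F.nodes ⊆ possibleNodes P := by
  rintro ⟨S, b⟩ hb
  refine ⟨hF.subgoal (hF.hasTree hb), ?_, ?_⟩
  · cases b with
    | nil => exact Nat.zero_le _
    | cons e b =>
      obtain ⟨hb', he⟩ := hF.edge hb
      have hlab : ∀ {N}, BKB.label P R S b = some N → (e :: b).length ≤ maxDepth P :=
        fun hN => hF.length_le hb' hN
      cases e with
      | clause k =>
        obtain ⟨rfl, -⟩ := he
        simp [maxDepth]
        omega
      | answer h f =>
        obtain ⟨-, N, a, hs⟩ := he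
        exact hlab hs.2.1
      | negSuccess =>
        obtain ⟨N, a, hs⟩ := he
        exact hlab hs.2.1
      | delay =>
        obtain ⟨N, a, hs⟩ := he
        exact hlab hs.2.1
      | simplify d =>
        obtain ⟨-, N, hN, -⟩ := he
        exact hlab hN
      | fail =>
        rcases he with ⟨N, a, hs, -⟩ | ⟨N, hN, -⟩
        · exact hlab hs.2.1
        · exact hlab hN
  · induction b with
    | nil => simp
    | cons e b ih =>
      obtain ⟨hb', he⟩ := hF.edge hb
      intro e' he'
      rcases List.mem_cons.1 he' with rfl | he'
      · exact he.mem_possibleEdges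
      · exact ih hb' e' he'

theorem completed_subset (hF : F.Sound P R Gy) : F.completed ⊆ {a | InLanguage P a} :=
  fun T hT => hF.subgoal (hF.completed T hT).1

theorem finite_nodes (hF : F.Sound P R Gy) : F.nodes.Finite :=
  (finite_possibleNodes P).subset hF.nodes_subset

end Forest.Sound

/-- The size of a forest, which grows with each SLG operation. -/
noncomputable def Forest.size (F : Forest C Q) : ℕ := F.nodes.ncard + F.completed.ncard

/-- A bound for the size of the forests of evaluations of the program `P`. -/
noncomputable def maxSize (P : Program C Q) : ℕ :=
  (possibleNodes P).ncard + {a : Atom C Q | InLanguage P a}.ncard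

theorem Forest.Sound.size_le (hF : F.Sound P R Gy) : F.size ≤ maxSize P :=
  add_le_add (Set.ncard_le_ncard hF.nodes_subset (finite_possibleNodes P))
    (Set.ncard_le_ncard hF.completed_subset (finite_inLanguage P))

theorem Forest.Sound.size_lt {F' : Forest C Q} (hF : F.Sound P R Gy) (h : SLGStep P R F F') :
    F.size < F'.size := by
  unfold Forest.size
  rcases h.cases_nodes with ⟨S', b', N', L, -, h2, rfl⟩ | ⟨S', b', e', -, h2, -, rfl⟩ |
    ⟨G, ⟨T, hT⟩, hG, hGce, rfl⟩
  · have := Set.ncard_insert_of_notMem h2 hF.finite_nodes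
    simp only [Forest.addNode, this]
    omega
  · have := Set.ncard_insert_of_notMem h2 hF.finite_nodes
    simp only [Forest.addNode, this]
    omega
  · refine Nat.add_lt_add_left (Set.ncard_lt_ncard ?_ ?_) _
    · exact Set.ssubset_iff_of_subset Set.subset_union_left |>.2
        ⟨T, .inr hT, Set.disjoint_left.1 hG hT⟩
    · refine (finite_inLanguage P).subset (Set.union_subset hF.completed_subset fun T hT => ?_)
      exact hF.subgoal (hGce T hT).1

end Finiteness

/-! ### Knowledge bases -/

section KnowledgeBase

variable {C : Type u} {Q : Type v}

/-- The symbols of the type constraints, and those of the heads and the direct influences of `PB`.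
Their answers are ground, by the type constraints on the head variables. -/
def KnowledgeBase.groundSyms (KB : KnowledgeBase C Q) : Set (Pred C Q × ℕ) :=
  {s | (∃ dom, s.1 = .member dom) ∨ ∃ c ∈ KB.PB, ∃ a ∈ c.head :: c.direct, a.sym = s}

theorem KnowledgeBase.rangeRestricted (KB : KnowledgeBase C Q) :
    RangeRestricted KB.program KB.groundSyms := by
  intro c hc hGy x hx
  simp only [KnowledgeBase.program, List.mem_append, List.mem_cons, List.mem_flatMap] at hc
  rcases hc with (hc | hc) | hc | ⟨c', -, hc⟩
  · obtain ⟨c, hcPB, rfl⟩ := List.mem_map.1 hc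
    obtain ⟨t, ht, rfl⟩ := KB.typed c hcPB x hx
    refine ⟨⟨.member t.2, [.var t.1]⟩, ?_, .inl ⟨t.2, rfl⟩, Atom.mem_vars.2 (by simp)⟩
    simp only [PBClause.toClause, List.mem_append, List.mem_cons, List.mem_map]
    exact .inr ⟨t, ht, rfl⟩
  · rcases hGy with ⟨dom, hd⟩ | ⟨c', hc', a, ha, hs⟩
    · obtain ⟨q, hq⟩ := KB.user_CB c hc
      rw [Atom.sym, hq] at hd
      cases hd
    · exact absurd hs.symm (KB.only_PB c' hc' a ha c hc _ c.head_mem_atoms)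
  · subst hc
    simp [Atom.vars] at hx
  · unfold Clause.memberFacts at hc
    simp only [List.mem_flatMap] at hc
    obtain ⟨L, -, hc⟩ := hc
    split at hc
    · obtain ⟨d, -, rfl⟩ := List.mem_map.1 hc
      simp [Atom.vars, Term.var?] at hx
    · simp at hc

theorem KnowledgeBase.getElem?_program {KB : KnowledgeBase C Q} {k : ℕ} {c : PBClause C Q}
    (h : KB.PB[k]? = some c) : KB.program[k]? = some c.toClause := by
  obtain ⟨hlt, rfl⟩ := List.getElem?_eq_some_iff.1 h
  simp [KnowledgeBase.program, List.getElem?_append, hlt]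

theorem mostGeneral_sym (s : Pred C Q × ℕ) : (mostGeneral s : Atom C Q).sym = s := by
  simp [mostGeneral, Atom.sym]

theorem PBClause.influence_comp {c : PBClause C Q} {θ : Subst C}
    (h : ∀ a ∈ c.head :: c.direct, (a.subst θ).IsGround) (k : ℕ) (γ : Subst C) :
    c.influence k (θ.comp γ) = c.influence k θ := by
  have key : ∀ a ∈ c.head :: c.direct, a.subst (θ.comp γ) = a.subst θ := fun a ha => by
    rw [Atom.subst_comp, (h a ha).subst_eq]
  simp only [PBClause.influence, InfluenceClause.mk.injEq, true_and]
  exact ⟨key _ List.mem_cons_self,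
    List.map_congr_left fun a ha => key a (List.mem_cons_of_mem _ ha)⟩

/-- The instances of a `PB` clause at its success branches are ground on the head and the direct
influences. -/
theorem LabelSound.isGround_influence [Inhabited C] {KB : KnowledgeBase C Q}
    {F : Forest C Q} {S : Atom C Q} {n : ℕ} {N : Label C Q} {c : PBClause C Q}
    (h : LabelSound KB.program KB.groundSyms F S n N c.toClause) (hc : KB.PB[N.clause]? = some c)
    (hg : N.goals = []) : ∀ a ∈ c.head :: c.direct, (a.subst N.subst).IsGround := by
  have hsym : ∀ a ∈ c.head :: c.direct, a.sym ∈ KB.groundSyms :=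
    fun a ha => .inr ⟨c, List.mem_of_getElem? hc, a, ha, rfl⟩
  intro a ha
  have ha' := hsym a ha
  rcases List.mem_cons.1 ha with rfl | ha
  · have := h.isGround_head KB.rangeRestricted hg (by
      rw [← h.inst.sym_eq, h.head, Atom.sym_subst]
      exact ha')
    rwa [h.head] at this
  · refine (h.ground a ?_ ha').resolve_left (by simp [hg])
    simp only [PBClause.toClause, List.mem_append, List.mem_map]
    exact .inl (.inl ⟨a, ha, rfl⟩)

variable [DecidableEq C] [DecidableEq Q]
variable {KB : KnowledgeBase C Q} {R : ComputationRule C Q} {F : Forest C Q}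

theorem KnowledgeBase.mem_topGoals {S : Atom C Q} :
    S ∈ KB.topGoals ↔ ∃ c ∈ KB.PB, mostGeneral c.head.sym = S := by
  simp [KnowledgeBase.topGoals]

theorem AlgState.returned_of_stuck {s : AlgState C Q} (hstuck : ∀ s', ¬ KB.AlgStep R s s')
    (hfl : ¬ KB.Floundered R s) : s.Returned := by
  obtain ⟨pending, current, out⟩ := s
  cases current with
  | none =>
    cases pending with
    | nil => exact ⟨rfl, rfl⟩
    | cons S gs => exact absurd (.next S gs out) (hstuck _)
  | some p =>
    obtain ⟨S, F⟩ := p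
    refine absurd (.finish S F pending out (fun F' hF' => ?_) fun h => hfl ⟨S, F, rfl, h⟩)
      (hstuck _)
    exact hstuck _ (.slg S F F' pending out hF')

theorem KnowledgeBase.inLanguage_of_mem_topGoals {S : Atom C Q} (h : S ∈ KB.topGoals) :
    InLanguage KB.program S := by
  obtain ⟨c, hc, rfl⟩ := KnowledgeBase.mem_topGoals.1 h
  obtain ⟨k, hk⟩ := List.mem_iff_getElem?.1 hc
  refine ⟨⟨c.toClause, List.mem_of_getElem? (KnowledgeBase.getElem?_program hk), _,
    Clause.head_mem_atoms _, (mostGeneral_sym _).symm⟩, fun d hd => ?_, fun x hx => ?_⟩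
  · rw [Atom.mem_consts] at hd
    simp [mostGeneral] at hd
  · rw [Atom.mem_vars] at hx
    simpa [mostGeneral] using hx

variable [Inhabited C]

/-- The success branches of the tree for `p(X₁, …, Xₙ)` yield exactly the influence clauses with
head predicate `p`. -/
theorem Forest.Sound.collect_eq (hF : F.Sound KB.program R KB.groundSyms)
    (hterm : ∀ F', ¬ SLGStep KB.program R F F') (hfl : ¬ F.Flounders KB.program R)
    {s : Pred C Q × ℕ} (hT : F.HasTree (mostGeneral s)) :
    KB.collect R F (mostGeneral s) = {ι ∈ KB.influenceClauses | ι.head.sym = s} := by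
  ext ι
  constructor
  · rintro ⟨b, N, c, hA, hd, hc, rfl⟩
    obtain ⟨c', hc'⟩ := hF.label hA.1.1 hA.2.1
    obtain rfl : c.toClause = c' := by
      have := hc'.clause
      rw [KnowledgeBase.getElem?_program hc, Option.some.injEq] at this
      exact this
    -- variables of the clause outside the head and the direct influences may be free at the success
    -- branch; they receive an arbitrary constant
    obtain ⟨e, he⟩ := HU_nonempty KB.program
    obtain ⟨σ, hσ, hστ⟩ := exists_comp_groundSubst
      (fun x k hx => constsOf_subset_HU _ (hc'.consts x k hx)) (τ := fun _ => e) fun _ => he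
    refine ⟨⟨N.clause, c, hc, σ, hσ, fun L hL => ?_, ?_⟩, ?_⟩
    · obtain ⟨L, hL', rfl⟩ := List.mem_map.1 hL
      exact hc'.body_true hA.2.2 hd hσ hστ L hL'
    · rw [← hστ, PBClause.influence_comp (hc'.isGround_influence hc hA.2.2)]
    · have := hc'.inst.sym_eq
      rw [hc'.head, mostGeneral_sym] at this
      exact this
  · rintro ⟨⟨k, c, hc, σ, hσ, hb, rfl⟩, hs⟩
    have hk := KnowledgeBase.getElem?_program hc
    have hs' : (c.toClause.head.subst (groundSubst σ)).sym = s := hs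
    obtain ⟨b, N, γ, hA, hd, hNk, hγ⟩ := hF.exists_success hterm hfl hT hk (σ := groundSubst σ)
      (by rw [← hs']; exact inst_mostGeneral _)
      fun L hL => (hb _ (List.mem_map_of_mem hL)).mono
        (hF.wellFoundedModel_le_tableInterp hterm hfl)
    obtain ⟨c', hc'⟩ := hF.label hA.1.1 hA.2.1
    obtain rfl : c.toClause = c' := by
      have := hc'.clause
      rw [hNk, hk, Option.some.injEq] at this
      exact this
    rw [← hNk] at hc
    refine ⟨b, N, c, hA, hd, hc, ?_⟩
    rw [← hγ, PBClause.influence_comp (hc'.isGround_influence hc hA.2.2), hNk]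

theorem Forest.Sound.finite_collect (hF : F.Sound KB.program R KB.groundSyms) (S : Atom C Q) :
    (KB.collect R F S).Finite := by
  refine (hF.finite_nodes.biUnion (t := fun p => {ι | ∃ N c,
    BKB.label KB.program R p.1 p.2 = some N ∧ KB.PB[N.clause]? = some c ∧
      ι = c.influence N.clause N.subst}) fun p _ => Set.Subsingleton.finite ?_).subset ?_
  · rintro _ ⟨N, c, hN, hc, rfl⟩ _ ⟨N', c', hN', hc', rfl⟩
    rw [hN, Option.some.injEq] at hN'
    subst hN'
    rw [hc, Option.some.injEq] at hc'
    rw [hc']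
  · rintro ι ⟨b, N, c, hA, -, hc, rfl⟩
    exact Set.mem_biUnion (x := (S, b)) hA.1.1 ⟨N, c, hA.2.1, hc, rfl⟩

/-! ### Runs of the algorithm -/

/-- The invariant of the algorithm: exactly the influence clauses for the goals in an initial
segment of the list of goals have been collected. -/
structure AlgState.Sound (KB : KnowledgeBase C Q) (R : ComputationRule C Q)
    (s : AlgState C Q) (done : List (Atom C Q)) : Prop where
  goals : KB.topGoals = done ++ ((s.current.map Prod.fst).toList ++ s.pending)
  forest : ∀ S F, s.current = some (S, F) →
    F.Sound KB.program R KB.groundSyms ∧ F.HasTree S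
  finite : s.collected.Finite
  collected : s.collected = {ι ∈ KB.influenceClauses | mostGeneral ι.head.sym ∈ done}

theorem AlgState.sound_start : AlgState.Sound KB R KB.start [] where
  goals := rfl
  forest S F h := by cases h
  finite := Set.finite_empty
  collected := by simp [KnowledgeBase.start]

theorem AlgState.Sound.step {s s' : AlgState C Q} {done : List (Atom C Q)}
    (h : AlgState.Sound KB R s done) (hs : KB.AlgStep R s s') :
    ∃ done', AlgState.Sound KB R s' done' := by
  cases hs with
  | next S gs out =>
    refine ⟨done, h.goals, ?_, h.finite, h.collected⟩
    rintro _ _ ⟨⟩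
    refine ⟨Forest.sound_init (KnowledgeBase.inLanguage_of_mem_topGoals (KB := KB) ?_), rfl⟩
    rw [h.goals]
    simp
  | slg S F F' gs out hstep =>
    refine ⟨done, h.goals, ?_, h.finite, h.collected⟩
    rintro _ _ ⟨⟩
    obtain ⟨hF, hT⟩ := h.forest S F rfl
    exact ⟨hF.step KB.rangeRestricted hstep, hstep.nodes_subset hT⟩
  | finish S F gs out hterm hfl =>
    obtain ⟨hF, hT⟩ := h.forest S F rfl
    refine ⟨done ++ [S], ?_, by rintro _ _ ⟨⟩, h.finite.union (hF.finite_collect S), ?_⟩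
    · rw [h.goals]
      simp
    · obtain ⟨c, -, rfl⟩ : ∃ c ∈ KB.PB, mostGeneral c.head.sym = S := by
        rw [← KnowledgeBase.mem_topGoals, h.goals]
        simp
      have hout : out = _ := h.collected
      simp only [hF.collect_eq hterm hfl hT]
      rw [hout]
      ext ι
      have hinj : mostGeneral ι.head.sym = mostGeneral c.head.sym ↔ ι.head.sym = c.head.sym :=
        ⟨fun h => by rw [← mostGeneral_sym ι.head.sym, h, mostGeneral_sym], fun h => by rw [h]⟩
      simp only [Set.mem_union, Set.mem_ofPred_eq, List.mem_append, List.mem_singleton, hinj]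
      tauto

/-- A rank that decreases with every step of the algorithm: the pending goals weigh more than any
evaluation of a single goal, and the forest under evaluation can only grow up to `maxSize`. -/
noncomputable def AlgState.rank (KB : KnowledgeBase C Q) (s : AlgState C Q) : ℕ :=
  s.pending.length * (maxSize KB.program + 2) +
    match s.current with
    | none => 0
    | some (_, F) => maxSize KB.program - F.size + 1

theorem AlgState.Sound.rank_lt {s s' : AlgState C Q} {done : List (Atom C Q)}
    (h : AlgState.Sound KB R s done) (hs : KB.AlgStep R s s') : s'.rank KB < s.rank KB := by
  cases hs with
  | next S gs out =>
    simp only [AlgState.rank, List.length_cons, Nat.add_mul]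
    omega
  | slg S F F' gs out hstep =>
    have hF := (h.forest S F rfl).1
    have h1 := hF.size_lt hstep
    have h2 := (hF.step KB.rangeRestricted hstep).size_le
    simp only [AlgState.rank]
    omega
  | finish S F gs out hterm hfl =>
    simp only [AlgState.rank]
    omega

theorem KnowledgeBase.not_exists_infinite_run (KB : KnowledgeBase C Q)
    (R : ComputationRule C Q) : ¬ ∃ run : ℕ → AlgState C Q,
      run 0 = KB.start ∧ ∀ n, KB.AlgStep R (run n) (run (n + 1)) := by
  rintro ⟨run, h0, hrun⟩
  have hsound : ∀ n, ∃ done, AlgState.Sound KB R (run n) done := by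
    intro n
    induction n with
    | zero => exact ⟨[], h0 ▸ AlgState.sound_start⟩
    | succ n ih =>
      obtain ⟨done, h⟩ := ih
      exact h.step (hrun n)
  have hanti : StrictAnti fun n => (run n).rank KB := strictAnti_nat_of_succ_lt fun n => by
    obtain ⟨done, h⟩ := hsound n
    exact h.rank_lt (hrun n)
  exact (WellFounded.not_rel_apply_succ (r := (· < ·)) fun n => (run n).rank KB).elim
    fun n hn => hn (hanti (Nat.lt_succ_self n))

end KnowledgeBase

end BKB

theorem mainTheorem3 {C : Type*} {Q : Type*} [DecidableEq C] [DecidableEq Q] [Inhabited C]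
    (KB : BKB.KnowledgeBase C Q) (R : BKB.ComputationRule C Q) :
    (¬ ∃ run : ℕ → BKB.AlgState C Q,
      run 0 = KB.start ∧ ∀ n, KB.AlgStep R (run n) (run (n + 1))) ∧
    ∀ s : BKB.AlgState C Q,
      Relation.ReflTransGen (KB.AlgStep R) KB.start s →
      (∀ s', ¬ KB.AlgStep R s s') →
      ¬ KB.Floundered R s →
        s.Returned ∧ s.collected.Finite ∧ s.collected = KB.influenceClauses := by
  refine ⟨KB.not_exists_infinite_run R, fun s hs hstuck hfl => ?_⟩
  have hret : s.Returned := BKB.AlgState.returned_of_stuck hstuck hfl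
  obtain ⟨done, h⟩ : ∃ done, BKB.AlgState.Sound KB R s done := by
    clear hstuck hfl hret
    induction hs with
    | refl => exact ⟨[], BKB.AlgState.sound_start⟩
    | tail _ hstep ih =>
      obtain ⟨done, h⟩ := ih
      exact h.step hstep
  refine ⟨hret, h.finite, h.collected.trans (Set.sep_eq_self_iff_mem_true.2 ?_)⟩
  rintro _ ⟨k, c, hc, σ, -, -, rfl⟩
  have hgoals := h.goals
  rw [hret.1, hret.2] at hgoals
  simp only [Option.map_none, Option.toList_none, List.append_nil] at hgoals
  rw [← hgoals, BKB.KnowledgeBase.mem_topGoals]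
  exact ⟨c, List.mem_of_getElem? hc, by rw [BKB.PBClause.influence, BKB.Atom.sym_subst]⟩
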